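/- **Setting.** Let $d\ge 1$, $L,\rho,\varepsilon,\delta,c>0$, $\lambda\ge 0$, and let $f:\mathbb R^d\to\mathbb R$ be twice continuously differentiable, with $\nabla f$ $L$-Lipschitz and $\nabla^2 f$ $\rho$-Lipschitz (Euclidean and spectral norm). Put $g(x)=\lambda\|x\|_1$ and $\Phi=f+g$, and suppose that $\Phi$ is bounded below, with infimum $\Phi^\star$. For $\eta>0$ let $\mathrm{prox}_{\eta g}(y)=\operatorname{argmin}_x\{\eta g(x)+\frac12\|x-y\|^2\}$, and let $$G(x)=\tfrac1\eta\bigl(x-\mathrm{prox}_{\eta g}[x-\eta\nabla f(x)]\bigr)$$ be the gradient mapping. A point $x$ is an *$\varepsilon$-second-order stationary point* if $\|G(x)\|\le\varepsilon$ and $\lambda_{\min}(\nabla^2 f(x))\ge-\sqrt{\rho\varepsilon}$. **Algorithm (Perturbed Proximal Descent).** Input: $x_0,L,\rho,\varepsilon,c,\delta,\Delta_\Phi$. Put $$\chi=3\max\Bigl\{\ln\tfrac{dL\Delta_\Phi}{c\varepsilon^2\delta},4\Bigr\},\quad \eta=\tfrac cL,\quad r=\tfrac{\sqrt c}{\chi^2}\tfrac{\varepsilon}{L},\quad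 g_{\rm thres}=\tfrac{\sqrt c}{\chi^2}\varepsilon,\quad \Phi_{\rm thres}=\tfrac{c}{\chi^3}\sqrt{\tfrac{\varepsilon^3}{\rho}},\quad t_{\rm thres}=\Bigl\lceil\tfrac{\chi}{c^2}\tfrac{L}{\sqrt{\rho\varepsilon}}\Bigr\rceil$$ (with $\chi=12$ if $\Delta_\Phi=0$) and $t_{\rm noise}=-t_{\rm thres}-1$. In iteration $t=0,1,2,\dots$: (i) if $\|G(x_t)\|<g_{\rm thres}$ and $t-t_{\rm noise}>t_{\rm thres}$, set $\tilde x_t=x_t$, $t_{\rm noise}=t$, and replace $x_t$ by $\tilde x_t+\xi_t$; (ii) if $t-t_{\rm noise}=t_{\rm thres}$ and $\Phi(x_t)-\Phi(\tilde x_{t_{\rm noise}})>-\Phi_{\rm thres}$, return $\tilde x_{t_{\rm noise}}$; (iii) otherwise set $x_{t+1}=\mathrm{prox}_{\eta g}[x_t-\eta\nabla f(x_t)]$. The $\xi_t$ are independent and uniformly distributed on the ball of radius $r$ around $0$. **Smallness of $\lambda$.** Put $\gamma=\sqrt{\rho\varepsilon}$, $\kappa=L/\gamma$, and $\mathscr T=\chi/(\eta\gamma)$.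 Assume that for some $\hat c\ge3$, $\mu\in(0,1]$ and $\theta\in(0,1)$ $$\lambda<\frac{(1-\eta L)^{\hat c\mathscr T}\,\mu\,\frac{1}{\kappa\chi^2}\,\sqrt\eta\,L^{3/2}\,\frac{\gamma}{\rho}\,(1+\eta\gamma\theta)}{2\sqrt d\,\bigl[(1-\eta L)\bigl(1-(1-\eta L)^{\hat c\mathscr T}\bigr)+\eta L\bigr]}.$$ **Theorem.** There is an absolute constant $c_{\max}>0$ such that for every $c\in(0,c_{\max}]$ there is a constant $K$, depending only on $c$, with the following property. In the above setting, for all $\delta>0$, $\varepsilon\le L^2/\rho$, $x_0\in\mathbb R^d$ and $\Delta_\Phi\ge\Phi(x_0)-\Phi^\star$, with probability at least $1-\delta$ the algorithm returns an $\varepsilon$-second-order stationary point within at most $$K\left(\frac{L(\Phi(x_0)-\Phi^\star)}{\varepsilon^2}\,\ell^4+\frac{L}{\sqrt{\rho\varepsilon}}\,\ell\right),\qquad \ell=\max\Bigl\{1,\ \ln\frac{dL\Delta_\Phi}{\varepsilon^2\delta}\Bigr\},$$ iterations (with $\ell=1$ if $\Delta_\Phi=0$). In particular, if $\Phi(x_0)-\Phi^\star\ge\sqrt{\varepsilon^3/\rho}$,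 the number of iterations is $O\bigl(\frac{L(\Phi(x_0)-\Phi^\star)}{\varepsilon^2}\,\ell^4\bigr)$. -/

import Mathlib

noncomputable section

namespace PPD

/-- `ℝ^d` with the Euclidean norm. -/
abbrev E (d : ℕ) : Type := EuclideanSpace ℝ (Fin d)

/-- The `ℓ¹` norm of a vector. -/
def l1 {d : ℕ} (x : E d) : ℝ := ∑ i, |x i|

/-- The objective `Φ = f + lam * ‖·‖₁`. -/
def Phi {d : ℕ} (f : E d → ℝ) (lam : ℝ) (x : E d) : ℝ := f x + lam * l1 x

/-- The global infimum `Φ*` of the objective (used only when `Φ` is bounded below). -/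
def PhiStar {d : ℕ} (f : E d → ℝ) (lam : ℝ) : ℝ := ⨅ x, Phi f lam x

/-- `x` minimizes `h z + ‖z - y‖² / 2` over all `z`. -/
def IsProx {d : ℕ} (h : E d → ℝ) (y x : E d) : Prop :=
  ∀ z, h x + ‖x - y‖ ^ 2 / 2 ≤ h z + ‖z - y‖ ^ 2 / 2

/-- The proximity operator `prox_h y = argmin_z h z + ‖z - y‖² / 2`. -/
def prox {d : ℕ} (h : E d → ℝ) (y : E d) : E d := Classical.epsilon (IsProx h y)

/-- For nonnegative multiples of the `ℓ¹` norm the minimum defining `prox` is attained. -/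
theorem isProx_prox_l1 {d : ℕ} {a : ℝ} (ha : 0 ≤ a) (y : E d) :
    IsProx (fun z => a * l1 z) y (prox (fun z => a * l1 z) y) := by
  refine Classical.epsilon_spec (p := IsProx (fun z => a * l1 z) y) ?_
  have hl : ∀ z : E d, 0 ≤ a * l1 z := fun z =>
    mul_nonneg ha (Finset.sum_nonneg fun i _ => abs_nonneg _)
  have hc : Continuous fun z : E d => a * l1 z + ‖z - y‖ ^ 2 / 2 := by
    unfold l1; fun_prop
  have ht : Filter.Tendsto (fun z : E d => a * l1 z + ‖z - y‖ ^ 2 / 2)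
      (Filter.cocompact (E d)) Filter.atTop := by
    have h1 : Filter.Tendsto (fun z : E d => ‖z - y‖) (Filter.cocompact (E d)) Filter.atTop := by
      have h0 := tendsto_norm_cocompact_atTop (E := E d)
      refine Filter.tendsto_atTop_mono (f := fun z : E d => ‖z‖ + (-‖y‖)) (fun z => ?_)
        (Filter.tendsto_atTop_add_const_right _ _ h0)
      have := norm_sub_norm_le z y
      linarith
    refine Filter.tendsto_atTop_mono (f := fun z : E d => ‖z - y‖ ^ 2 / 2) (fun z => ?_)
      (((Filter.tendsto_pow_atTop (two_ne_zero)).comp h1).atTop_div_const (by norm_num))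
    have := hl z
    linarith
  exact hc.exists_forall_le ht

/-- One proximal gradient step with stepsize `η`. -/
def proxStep {d : ℕ} (f : E d → ℝ) (lam η : ℝ) (x : E d) : E d :=
  prox (fun z => η * (lam * l1 z)) (x - η • gradient f x)

/-- The gradient mapping, normalized so that it is `∇f` when `lam = 0`. -/
def gradMap {d : ℕ} (f : E d → ℝ) (lam η : ℝ) (x : E d) : E d :=
  η⁻¹ • (x - proxStep f lam η x)

/-- The Hessian `∇²f x`, as a continuous linear map. -/
def hessian {d : ℕ} (f : E d → ℝ) (x : E d) : E d →L[ℝ] E d := fderiv ℝ (gradient f) x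

/-- `f` is twice continuously differentiable, `∇f` is `L`-Lipschitz, and `∇²f` is `ρ`-Lipschitz
in the spectral norm. -/
structure LipschitzAssumption {d : ℕ} (f : E d → ℝ) (L ρ : ℝ) : Prop where
  contDiff : ContDiff ℝ 2 f
  gradient_lipschitz : ∀ x y, ‖gradient f x - gradient f y‖ ≤ L * ‖x - y‖
  hessian_lipschitz : ∀ x y, ‖hessian f x - hessian f y‖ ≤ ρ * ‖x - y‖

/-- `ε`-second-order stationarity: the gradient mapping has norm at most `ε` and every eigenvalue
of the Hessian (hence the smallest one) is at least `-√(ρ ε)`. -/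
def IsSecondOrderStationary {d : ℕ} (f : E d → ℝ) (lam η ρ ε : ℝ) (x : E d) : Prop :=
  ‖gradMap f lam η x‖ ≤ ε ∧
    ∀ a : ℝ, Module.End.HasEigenvalue (hessian f x : E d →ₗ[ℝ] E d) a → -√(ρ * ε) ≤ a

/-- The numerical input of the algorithm: dimension, Lipschitz constants of gradient and Hessian,
tolerance, stepsize constant, failure probability, estimated gap of function values. -/
structure Params where
  d : ℕ
  L : ℝ
  ρ : ℝ
  ε : ℝ
  c : ℝ
  δ : ℝ
  ΔΦ : ℝ

namespace Params

variable (p : Params)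

/-- The logarithmic parameter of the algorithm. -/
def χ : ℝ := 3 * max (Real.log (p.d * p.L * p.ΔΦ / (p.c * p.ε ^ 2 * p.δ))) 4

/-- The stepsize. -/
def η : ℝ := p.c / p.L

/-- The radius of the perturbation. -/
def r : ℝ := √p.c / p.χ ^ 2 * (p.ε / p.L)

/-- The threshold for the norm of the gradient mapping. -/
def gThres : ℝ := √p.c / p.χ ^ 2 * p.ε

/-- The threshold for the decrease of the objective. -/
def PhiThres : ℝ := p.c / p.χ ^ 3 * √(p.ε ^ 3 / p.ρ)

/-- The waiting time, rounded up to an integer number of iterations. -/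
def tThres : ℕ := ⌈p.χ / p.c ^ 2 * (p.L / √(p.ρ * p.ε))⌉₊

/-- The curvature scale `γ = √(ρ ε)`. -/
def γ : ℝ := √(p.ρ * p.ε)

/-- The condition number `κ = L / γ`. -/
def κ : ℝ := p.L / p.γ

/-- The failure probability `d κ exp (-χ)` allotted to a single perturbation. -/
def δ₁ : ℝ := p.d * p.κ * Real.exp (-p.χ)

/-- The logarithmic factor `ln (d κ / δ₁)`; it equals `χ`. -/
def logFactor : ℝ := Real.log (p.d * p.κ / p.δ₁)

/-- The time unit `ln (d κ / δ₁) / (η γ)`. -/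
def timeUnit : ℝ := p.logFactor / (p.η * p.γ)

/-- The upper bound on the weight of the `ℓ¹` norm, in terms of constants `chat`, `μ`, `θ`. -/
def lamBound (chat μ θ : ℝ) : ℝ :=
  ((1 - p.η * p.L) ^ (chat * p.timeUnit) * μ * (1 / (p.κ * p.logFactor ^ 2)) * √p.η
      * p.L ^ (3 / 2 : ℝ) * (p.γ / p.ρ) * (1 + p.η * p.γ * θ)) /
    (2 * √(p.d : ℝ) *
      ((1 - p.η * p.L) * (1 - (1 - p.η * p.L) ^ (chat * p.timeUnit)) + p.η * p.L))

end Params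

/-- State of the algorithm at the beginning of an iteration: the iterate `x_t`, the last point
`x̃` that was perturbed, the time of that perturbation, and the returned point, if any. -/
structure State (d : ℕ) where
  x : E d
  anchor : E d
  tNoise : ℤ
  output : Option (E d)

/-- The initial state; the anchor is a dummy until the first perturbation. -/
def initState (p : Params) (x₀ : E p.d) : State p.d where
  x := x₀
  anchor := x₀
  tNoise := -(p.tThres : ℤ) - 1
  output := none

open Classical in
/-- First instruction of iteration `t`: perturb the iterate by `ξ` if the gradient mapping is small
and there was no perturbation during the last `tThres` iterations. -/
def perturb (p : Params) (f : E p.d → ℝ) (lam : ℝ) (t : ℕ) (ξ : E p.d) (s : State p.d) :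
    State p.d :=
  if ‖gradMap f lam p.η s.x‖ < p.gThres ∧ (p.tThres : ℤ) < (t : ℤ) - s.tNoise then
    { s with x := s.x + ξ, anchor := s.x, tNoise := t }
  else s

open Classical in
/-- Second and third instruction of iteration `t`: return the anchor if exactly `tThres` iterations
after a perturbation the objective has not decreased enough, otherwise do a proximal step. -/
def returnOrDescend (p : Params) (f : E p.d → ℝ) (lam : ℝ) (t : ℕ) (s : State p.d) : State p.d :=
  if (t : ℤ) - s.tNoise = (p.tThres : ℤ) ∧ -p.PhiThres < Phi f lam s.x - Phi f lam s.anchor then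
    { s with output := some s.anchor }
  else { s with x := proxStep f lam p.η s.x }

/-- Iteration `t` of the algorithm with random vector `ξ`; a run that has returned stays put. -/
def iteration (p : Params) (f : E p.d → ℝ) (lam : ℝ) (t : ℕ) (ξ : E p.d) (s : State p.d) :
    State p.d :=
  match s.output with
  | some _ => s
  | none => returnOrDescend p f lam t (perturb p f lam t ξ s)

/-- Perturbed Proximal Descent: the state after the iterations `0, …, n - 1`, where `ξ t` is the
random vector available in iteration `t`. -/
def run (p : Params) (f : E p.d → ℝ) (lam : ℝ) (x₀ : E p.d) (ξ : ℕ → E p.d) : ℕ → State p.d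
  | 0 => initState p x₀
  | n + 1 => iteration p f lam n (ξ n) (run p f lam x₀ ξ n)

/-- The logarithm in the iteration bound, cut off below at `1`. -/
def logTerm (p : Params) : ℝ := max 1 (Real.log (p.d * p.L * p.ΔΦ / (p.ε ^ 2 * p.δ)))

/-- The iteration bound up to its constant factor, for the initial gap `gap = Φ x₀ - Φ*`. -/
def iterBound (p : Params) (gap : ℝ) : ℝ :=
  p.L * gap / p.ε ^ 2 * logTerm p ^ 4 + p.L / √(p.ρ * p.ε) * logTerm p

end PPD

end

noncomputable section

namespace PPD

open MeasureTheory ProbabilityTheory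
open scoped RealInnerProductSpace

section

variable {d : ℕ}

/-! ### The proximity operator of a multiple of the `ℓ¹` norm -/

/-! A proximal step lowers `Phi` by at least `‖step‖² / (2η)`. So a step with gradient mapping at
least `gThres` pays a fixed amount, and a perturbation cycle either pays `PhiThres` or ends the run.
Since `Phi` is bounded below, the running time is bounded for every realization of the noise
(`Setting.runPhase`, `Setting.le_of_output_eq_none`); chance only decides whether the returned point
is a saddle.

A saddle is returned only if its perturbed copy is `Stuck`. Stuck trajectories stay localized,
because travelling costs objective (`Setting.norm_iterate_sub_le`). On the other hand, two
trajectories that start at distance `s` along the most negative Hessian eigenvector `e` separate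
exponentially: the linearized step multiplies their difference along `e` by `β = 1 - η a > 1 + η γ`,
and no direction grows faster. The variation of the Hessian and the `ℓ¹` term are small errors, the
latter because the proximity operator moves a point by at most `η λ √d` with `λ` exponentially
small. For `s ≥ r κ exp (-χ) / 3` separation contradicts localization (`Setting.not_both_stuck`).
The stuck perturbations therefore form a set that is thin along `e` and fills at most a fraction
`δ₁` of the ball (`volume_le_of_thin`, `Setting.volume_stuck_le`).

The noise is independent of the past, so the failure probability is at most `δ₁` times the expected
number of perturbed saddles. On every run that number is at most `gap / PhiThres`, with no
additional `+ 1`, since a saddle lies at least `PhiThres` above the infimum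
(`Setting.exists_Phi_le_of_isSaddle`). The choice of `χ` makes the product at most `δ`. -/

theorem convexOn_mul_l1 {a : ℝ} (ha : 0 ≤ a) :
    ConvexOn ℝ Set.univ fun z : E d => a * l1 z := by
  refine ⟨convex_univ, fun x _ y _ s t hs ht _ => ?_⟩
  simp only [l1, smul_eq_mul, Finset.mul_sum, ← Finset.sum_add_distrib]
  refine Finset.sum_le_sum fun i _ => ?_
  have h : |s * x i + t * y i| ≤ s * |x i| + t * |y i| := by
    refine (abs_add_le _ _).trans ?_
    rw [abs_mul, abs_mul, abs_of_nonneg hs, abs_of_nonneg ht]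
  have := mul_le_mul_of_nonneg_left h ha
  simp only [PiLp.add_apply, PiLp.smul_apply, smul_eq_mul]
  linarith

/-- The variational inequality characterizing a proximal point of a convex function. -/
theorem IsProx.inner_le {h : E d → ℝ} (hh : ConvexOn ℝ Set.univ h) {y x : E d}
    (hx : IsProx h y x) (z : E d) : ⟪y - x, z - x⟫ ≤ h z - h x := by
  -- Compare `x` with the point `x + t (z - x)`, divide by `t`, and let `t` tend to `0`; the limit
  -- is replaced below by an explicit small `t`.
  have key : ∀ t : ℝ, 0 < t → t ≤ 1 →
      ⟪y - x, z - x⟫ ≤ h z - h x + t * (‖z - x‖ ^ 2 / 2) := by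
    intro t ht ht1
    have h1 := hx (x + t • (z - x))
    have h2 : h (x + t • (z - x)) ≤ (1 - t) * h x + t * h z := by
      have := hh.2 (Set.mem_univ x) (Set.mem_univ z) (by linarith : (0 : ℝ) ≤ 1 - t) ht.le
        (by ring)
      have e1 : (1 - t) • x + t • z = x + t • (z - x) := by
        rw [smul_sub, sub_smul, one_smul]; abel
      rwa [e1] at this
    have h3 : ‖x + t • (z - x) - y‖ ^ 2
        = ‖x - y‖ ^ 2 - 2 * (t * ⟪y - x, z - x⟫) + t ^ 2 * ‖z - x‖ ^ 2 := by
      have : x + t • (z - x) - y = (x - y) + t • (z - x) := by abel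
      rw [this, norm_add_sq_real, inner_smul_right, norm_smul, mul_pow, Real.norm_eq_abs, sq_abs,
        ← neg_sub y x, inner_neg_left]
      simp only [norm_neg]
      ring
    rw [h3] at h1
    have h4 : t * ⟪y - x, z - x⟫ ≤ t * (h z - h x + t * (‖z - x‖ ^ 2 / 2)) := by nlinarith
    exact le_of_mul_le_mul_left h4 ht
  refine le_of_forall_pos_le_add fun e he => ?_
  have hpos : 0 < ‖z - x‖ ^ 2 / 2 + 1 := by positivity
  have h1 := key (min 1 (e / (‖z - x‖ ^ 2 / 2 + 1))) (lt_min one_pos (by positivity))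
    (min_le_left _ _)
  have h2 : min 1 (e / (‖z - x‖ ^ 2 / 2 + 1)) * (‖z - x‖ ^ 2 / 2) ≤ e := by
    calc _ ≤ e / (‖z - x‖ ^ 2 / 2 + 1) * (‖z - x‖ ^ 2 / 2 + 1) :=
          mul_le_mul (min_le_right _ _) (by linarith) (by positivity) (by positivity)
      _ = e := by field_simp
  linarith

/-- Adding the two variational inequalities, each tested at the other proximal point, cancels the
`ℓ¹` terms and gives `‖x - x'‖² ≤ ⟪y - y', x - x'⟫`. -/
theorem norm_prox_sub_prox_le {a : ℝ} (ha : 0 ≤ a) (y y' : E d) :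
    ‖prox (fun z => a * l1 z) y - prox (fun z => a * l1 z) y'‖ ≤ ‖y - y'‖ := by
  set x := prox (fun z => a * l1 z) y
  set x' := prox (fun z => a * l1 z) y'
  have h1 := (isProx_prox_l1 ha y).inner_le (convexOn_mul_l1 ha) x'
  have h2 := (isProx_prox_l1 ha y').inner_le (convexOn_mul_l1 ha) x
  change ⟪y - x, x' - x⟫ ≤ a * l1 x' - a * l1 x at h1
  change ⟪y' - x', x - x'⟫ ≤ a * l1 x - a * l1 x' at h2
  have h3 : ‖x - x'‖ * ‖x - x'‖ ≤ ‖y - y'‖ * ‖x - x'‖ := by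
    refine le_trans ?_ (real_inner_le_norm (y - y') (x - x'))
    rw [← real_inner_self_eq_norm_mul_norm]
    have e1 : ⟪y - x, x' - x⟫ = - ⟪y - x, x - x'⟫ := by rw [← inner_neg_right, neg_sub]
    have e2 : ⟪y - y', x - x'⟫ - ⟪x - x', x - x'⟫ = ⟪y - x, x - x'⟫ - ⟪y' - x', x - x'⟫ := by
      rw [← inner_sub_left, ← inner_sub_left]; congr 1; abel
    linarith
  rcases (norm_nonneg (x - x')).eq_or_lt with h | h
  · rw [← h]; exact norm_nonneg _
  · exact le_of_mul_le_mul_right h3 h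

theorem l1_sub_l1_le (x y : E d) : l1 x - l1 y ≤ √d * ‖x - y‖ := by
  have h1 : l1 x - l1 y ≤ ∑ i, |(x - y) i| := by
    rw [l1, l1, ← Finset.sum_sub_distrib]
    exact Finset.sum_le_sum fun i _ => abs_sub_abs_le_abs_sub _ _
  refine h1.trans ((Real.le_sqrt_of_sq_le (y := d * ‖x - y‖ ^ 2) ?_).trans_eq ?_)
  · have := sq_sum_le_card_mul_sum_sq (s := Finset.univ) (f := fun i => |(x - y) i|)
    simpa [EuclideanSpace.norm_sq_eq] using this
  · rw [Real.sqrt_mul (by positivity), Real.sqrt_sq (norm_nonneg _)]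

theorem norm_sub_prox_le {a : ℝ} (ha : 0 ≤ a) (y : E d) :
    ‖y - prox (fun z => a * l1 z) y‖ ≤ a * √d := by
  set x := prox (fun z => a * l1 z) y
  have h1 := (isProx_prox_l1 ha y).inner_le (convexOn_mul_l1 ha) y
  change ⟪y - x, y - x⟫ ≤ a * l1 y - a * l1 x at h1
  rw [real_inner_self_eq_norm_mul_norm] at h1
  have h2 := mul_le_mul_of_nonneg_left (l1_sub_l1_le y x) ha
  rcases (norm_nonneg (y - x)).eq_or_lt with h | h
  · rw [← h]; positivity
  · exact le_of_mul_le_mul_right (by linarith : ‖y - x‖ * ‖y - x‖ ≤ a * √d * ‖y - x‖) h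

/-- A proximal step is a gradient step up to an error independent of the point, so the saddle
analysis of smooth gradient descent applies with an additive error. -/
theorem norm_proxStep_sub_le {f : E d → ℝ} {lam η : ℝ} (hη : 0 ≤ η) (hl : 0 ≤ lam) (x : E d) :
    ‖x - η • gradient f x - proxStep f lam η x‖ ≤ η * lam * √d := by
  have := norm_sub_prox_le (mul_nonneg hη hl) (x - η • gradient f x)
  simp only [mul_assoc] at this ⊢
  exact this

/-! ### Consequences of the Lipschitz assumptions -/

namespace LipschitzAssumption

variable {f : E d → ℝ} {L ρ : ℝ} (hf : LipschitzAssumption f L ρ)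
include hf

theorem hasGradientAt (x : E d) : HasGradientAt f (gradient f x) x :=
  ((hf.contDiff.differentiable (by norm_num)) x).hasGradientAt

theorem gradient_contDiff : ContDiff ℝ 1 (gradient f) := by
  have h1 : ContDiff ℝ 1 (fderiv ℝ f) := hf.contDiff.fderiv_right (by norm_num)
  exact (InnerProductSpace.toDual ℝ (E d)).symm.toContinuousLinearEquiv.contDiff.comp h1

theorem hasFDerivAt_gradient (x : E d) : HasFDerivAt (gradient f) (hessian f x) x :=
  ((hf.gradient_contDiff.differentiable (by norm_num)) x).hasFDerivAt

theorem continuous_hessian : Continuous (hessian f) :=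
  hf.gradient_contDiff.continuous_fderiv (by norm_num)

theorem continuous_gradient : Continuous (gradient f) := hf.gradient_contDiff.continuous

theorem norm_hessian_le (hL : 0 ≤ L) (x : E d) : ‖hessian f x‖ ≤ L := by
  have : LipschitzWith ⟨L, hL⟩ (gradient f) :=
    LipschitzWith.of_dist_le_mul fun x y => by
      rw [dist_eq_norm, dist_eq_norm]
      exact hf.gradient_lipschitz x y
  exact norm_fderiv_le_of_lipschitz ℝ this

theorem inner_hessian_comm (x u v : E d) :
    ⟪hessian f x u, v⟫ = ⟪u, hessian f x v⟫ := by
  have hs : IsSymmSndFDerivAt ℝ f x := hf.contDiff.contDiffAt.isSymmSndFDerivAt (by simp)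
  have key : ∀ u v : E d, ⟪hessian f x u, v⟫ = fderiv ℝ (fderiv ℝ f) x u v := by
    intro u v
    have h1 : HasFDerivAt (fderiv ℝ f)
        ((InnerProductSpace.toDual ℝ (E d)).toContinuousLinearEquiv.toContinuousLinearMap.comp
          (hessian f x)) x := by
      have := (InnerProductSpace.toDual ℝ
        (E d)).toContinuousLinearEquiv.toContinuousLinearMap.hasFDerivAt.comp x
          (hf.hasFDerivAt_gradient x)
      have e1 : fderiv ℝ f = fun y => InnerProductSpace.toDual ℝ (E d) (gradient f y) :=
        funext fun y => (toDual_gradient (𝕜 := ℝ)).symm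
      rw [e1]
      exact this
    rw [h1.fderiv]
    simp
  rw [key, real_inner_comm, key, hs.eq]

/-- Mean value inequality for `∇f` minus its linearization at `x`: on the ball of radius `R` the
Hessian differs from `hessian f x` by at most `ρ R`. -/
theorem norm_gradient_sub_sub_le (hρ : 0 ≤ ρ) {x u w : E d} {R : ℝ} (hu : ‖u - x‖ ≤ R)
    (hw : ‖w - x‖ ≤ R) :
    ‖gradient f w - gradient f u - hessian f x (w - u)‖ ≤ ρ * R * ‖w - u‖ := by
  refine (convex_closedBall x R).norm_image_sub_le_of_norm_hasFDerivWithin_le'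
    (fun y _ => (hf.hasFDerivAt_gradient y).hasFDerivWithinAt) (fun y hy => ?_) ?_ ?_
  · refine (hf.hessian_lipschitz y x).trans (mul_le_mul_of_nonneg_left ?_ hρ)
    rwa [mem_closedBall_iff_norm] at hy
  · rwa [mem_closedBall_iff_norm]
  · rwa [mem_closedBall_iff_norm]

/-- A bound for the directional derivative along a segment by a quadratic polynomial yields a bound
for the increment of the function. -/
theorem line_le (x v : E d) {S a b k : ℝ} (hS : 0 ≤ S)
    (h : ∀ s, 0 ≤ s → s ≤ S → ⟪gradient f (x + s • v), v⟫ ≤ a + b * s + k * s ^ 2) :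
    f (x + S • v) ≤ f x + (a * S + b * S ^ 2 / 2 + k * S ^ 3 / 3) := by
  have hd : ∀ s : ℝ, HasDerivAt (fun s : ℝ => f (x + s • v) -
      (a * s + b * s ^ 2 / 2 + k * s ^ 3 / 3))
      (⟪gradient f (x + s • v), v⟫ - (a + b * s + k * s ^ 2)) s := by
    intro s
    have h1 : HasDerivAt (fun s : ℝ => x + s • v) v s := by
      simpa using ((hasDerivAt_id s).smul_const v).const_add x
    have h2 := (hf.hasGradientAt (x + s • v)).hasFDerivAt.comp_hasDerivAt s h1
    rw [InnerProductSpace.toDual_apply_apply] at h2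
    refine HasDerivAt.sub h2 ?_
    have h3 := ((hasDerivAt_id s).const_mul a).add
      ((((hasDerivAt_id s).pow 2).const_mul (b / 2)).add
      (((hasDerivAt_id s).pow 3).const_mul (k / 3)))
    convert h3 using 1
    · ext s; simp; ring
    · simp; ring
  have hanti : AntitoneOn (fun s : ℝ => f (x + s • v) -
      (a * s + b * s ^ 2 / 2 + k * s ^ 3 / 3)) (Set.Icc 0 S) := by
    refine antitoneOn_of_deriv_nonpos (convex_Icc 0 S)
      (fun s _ => (hd s).continuousAt.continuousWithinAt)
      (fun s _ => (hd s).differentiableAt.differentiableWithinAt) fun s hs => ?_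
    rw [interior_Icc] at hs
    rw [(hd s).deriv]
    linarith [h s hs.1.le hs.2.le]
  have := hanti (Set.left_mem_Icc.2 hS) (Set.right_mem_Icc.2 hS) hS
  simp at this
  linarith

theorem le_quadratic (x y : E d) :
    f y ≤ f x + ⟪gradient f x, y - x⟫ + L / 2 * ‖y - x‖ ^ 2 := by
  have h := hf.line_le x (y - x) (a := ⟪gradient f x, y - x⟫) (b := L * ‖y - x‖ ^ 2) (k := 0)
    zero_le_one fun s hs _ => ?_
  · rw [one_smul, add_sub_cancel] at h; linarith
  · have h1 : ⟪gradient f (x + s • (y - x)) - gradient f x, y - x⟫ ≤ L * ‖y - x‖ ^ 2 * s := by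
      refine (real_inner_le_norm _ _).trans ?_
      have h2 := hf.gradient_lipschitz (x + s • (y - x)) x
      rw [add_sub_cancel_left, norm_smul, Real.norm_of_nonneg hs] at h2
      have := mul_le_mul_of_nonneg_right h2 (norm_nonneg (y - x))
      linarith
    rw [inner_sub_left] at h1
    linarith

theorem continuous_proxStep {lam η : ℝ} (hη : 0 ≤ η) (hl : 0 ≤ lam) :
    Continuous (proxStep f lam η) := by
  have h1 : Continuous (prox fun z : E d => η * (lam * l1 z)) := by
    simp only [← mul_assoc]
    refine (LipschitzWith.of_dist_le_mul (K := 1) fun x y => ?_).continuous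
    simpa [dist_eq_norm] using norm_prox_sub_prox_le (mul_nonneg hη hl) x y
  exact h1.comp (continuous_id.sub (hf.continuous_gradient.const_smul η))

theorem continuous_Phi (lam : ℝ) : Continuous (Phi f lam) := by
  have := hf.contDiff.continuous
  unfold Phi l1
  fun_prop

/-- The variational inequality tested at `x` gains `‖y - x‖² / η`; the quadratic upper bound for `f`
gives back at most half of it because `η L ≤ 1`. -/
theorem Phi_proxStep_le {lam η : ℝ} (hη : 0 < η) (hηL : η * L ≤ 1) (hl : 0 ≤ lam) (x : E d) :
    Phi f lam (proxStep f lam η x) + ‖proxStep f lam η x - x‖ ^ 2 / (2 * η) ≤ Phi f lam x := by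
  set y := proxStep f lam η x with hy
  have hp : IsProx (fun z => η * lam * l1 z) (x - η • gradient f x) y := by
    have := isProx_prox_l1 (mul_nonneg hη.le hl) (x - η • gradient f x)
    simp only [mul_assoc] at this ⊢
    exact this
  have h1 := hp.inner_le (convexOn_mul_l1 (mul_nonneg hη.le hl)) x
  have h2 : ⟪x - η • gradient f x - y, x - y⟫ = ‖y - x‖ ^ 2 + η * ⟪gradient f x, y - x⟫ := by
    have : x - η • gradient f x - y = -(y - x) - η • gradient f x := by abel
    rw [this, ← neg_sub y x, inner_neg_right, inner_sub_left, inner_neg_left, inner_smul_left,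
      real_inner_self_eq_norm_sq]
    simp; ring
  rw [h2] at h1
  have h3 := hf.le_quadratic x y
  have h4 : ⟪gradient f x, y - x⟫ ≤ lam * l1 x - lam * l1 y - ‖y - x‖ ^ 2 / η := by
    have : η * ⟪gradient f x, y - x⟫ ≤ η * (lam * l1 x - lam * l1 y - ‖y - x‖ ^ 2 / η) := by
      rw [mul_sub, mul_div_cancel₀ _ hη.ne']
      linarith
    exact le_of_mul_le_mul_left this hη
  have h5 : L / 2 * ‖y - x‖ ^ 2 ≤ ‖y - x‖ ^ 2 / (2 * η) := by
    rw [le_div_iff₀ (by positivity)]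
    nlinarith [sq_nonneg ‖y - x‖]
  have h6 : ‖y - x‖ ^ 2 / η = 2 * (‖y - x‖ ^ 2 / (2 * η)) := by field_simp
  unfold Phi
  linarith

end LipschitzAssumption

theorem norm_proxStep_sub_eq {f : E d → ℝ} {lam η : ℝ} (hη : 0 < η) (x : E d) :
    ‖proxStep f lam η x - x‖ = η * ‖gradMap f lam η x‖ := by
  rw [gradMap, norm_smul, Real.norm_of_nonneg (by positivity), ← mul_assoc,
    mul_inv_cancel₀ hη.ne', one_mul, norm_sub_rev]

/-! ### Symmetric operators bounded by `L` -/

/-- A symmetric operator has a unit eigenvector for its smallest eigenvalue `a`; the corresponding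
gradient step expands distances at most by the factor `1 - η a`. -/
theorem exists_min_eigenvector (hd : 1 ≤ d) (H : E d →L[ℝ] E d)
    (hH : ∀ u v, ⟪H u, v⟫ = ⟪u, H v⟫) {L : ℝ} (hL : ‖H‖ ≤ L) :
    ∃ (a : ℝ) (e : E d), ‖e‖ = 1 ∧ H e = a • e ∧ (∀ v, a * ‖v‖ ^ 2 ≤ ⟪H v, v⟫) ∧ -L ≤ a ∧
      ∀ η : ℝ, 0 ≤ η → η * L ≤ 1 → ∀ v, ‖v - η • H v‖ ≤ (1 - η * a) * ‖v‖ := by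
  have hsym : (H : E d →ₗ[ℝ] E d).IsSymmetric := hH
  have hn : Module.finrank ℝ (E d) = d := by simp
  let b := hsym.eigenvectorBasis hn
  let l := hsym.eigenvalues hn
  have hb : ∀ i, H (b i) = l i • b i := fun i => hsym.apply_eigenvectorBasis hn i
  have hin : ∀ v i, ⟪b i, H v⟫ = l i * ⟪b i, v⟫ := by
    intro v i
    rw [← hH, hb, inner_smul_left]; simp
  have habs : ∀ i, |l i| ≤ L := by
    intro i
    have h1 := (H.le_opNorm (b i)).trans (mul_le_mul_of_nonneg_right hL (norm_nonneg _))
    rw [hb, norm_smul, b.norm_eq_one i] at h1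
    simpa using h1
  have : Nonempty (Fin d) := ⟨⟨0, hd⟩⟩
  obtain ⟨i, hi⟩ := Finite.exists_min l
  have hsq : ∀ v : E d, ‖v‖ ^ 2 = ∑ j, ⟪b j, v⟫ ^ 2 := by
    intro v
    rw [← b.sum_sq_norm_inner_right v]; simp
  refine ⟨l i, b i, b.norm_eq_one i, hb i, fun v => ?_, (abs_le.1 (habs i)).1,
    fun η hη hηL v => ?_⟩
  · rw [← b.sum_inner_mul_inner, hsq, Finset.mul_sum]
    refine Finset.sum_le_sum fun j _ => ?_
    rw [real_inner_comm (b j), hin]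
    nlinarith [hi j, sq_nonneg ⟪b j, v⟫]
  · have h0 : 0 ≤ 1 - η * l i := by nlinarith [(abs_le.1 (habs i)).2]
    refine le_of_sq_le_sq ?_ (by positivity)
    rw [mul_pow, hsq, hsq, Finset.mul_sum]
    refine Finset.sum_le_sum fun j _ => ?_
    rw [inner_sub_right, inner_smul_right, hin]
    -- As `η L ≤ 1`, all factors `1 - η l j` are nonnegative, so squaring preserves their order and
    -- the smallest eigenvalue has the largest factor.
    have h1 : 0 ≤ 1 - η * l j := by nlinarith [(abs_le.1 (habs j)).2]
    have h2 : 1 - η * l j ≤ 1 - η * l i := by nlinarith [hi j]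
    have h3 : (1 - η * l j) ^ 2 ≤ (1 - η * l i) ^ 2 := pow_le_pow_left₀ h1 h2 2
    calc _ = (1 - η * l j) ^ 2 * ⟪b j, v⟫ ^ 2 := by ring
      _ ≤ _ := mul_le_mul_of_nonneg_right h3 (sq_nonneg _)

end

/-! ### The parameters -/

namespace Params

/-- Admissible numerical inputs. -/
structure Admissible (p : Params) : Prop where
  d_pos : 1 ≤ p.d
  L_pos : 0 < p.L
  ρ_pos : 0 < p.ρ
  ε_pos : 0 < p.ε
  ε_le : p.ε ≤ p.L ^ 2 / p.ρ
  c_pos : 0 < p.c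
  c_le : p.c ≤ 1 / 10000

theorem twelve_le_χ (p : Params) : 12 ≤ p.χ := by
  unfold χ
  linarith [le_max_right (Real.log (p.d * p.L * p.ΔΦ / (p.c * p.ε ^ 2 * p.δ))) 4]

theorem tThres_eq (p : Params) : p.tThres = ⌈p.χ * p.κ / p.c ^ 2⌉₊ := by
  rw [tThres, ← γ, ← κ, div_mul_eq_mul_div]

namespace Admissible

variable {p : Params} (hp : p.Admissible)
include hp

theorem γ_pos : 0 < p.γ := Real.sqrt_pos.2 (mul_pos hp.ρ_pos hp.ε_pos)

/-- Together with `L_eq` this expresses all parameters through `γ`, `κ`, `ρ`, `χ` and `c`;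
comparisons between them then reduce to monomial identities. -/
theorem ε_eq : p.ε = p.γ ^ 2 / p.ρ := by
  rw [γ, Real.sq_sqrt (mul_pos hp.ρ_pos hp.ε_pos).le]
  field_simp [hp.ρ_pos.ne']

theorem one_le_κ : 1 ≤ p.κ := by
  rw [κ, le_div_iff₀ hp.γ_pos, one_mul, γ]
  refine Real.sqrt_le_iff.2 ⟨hp.L_pos.le, ?_⟩
  have := mul_le_mul_of_nonneg_left hp.ε_le hp.ρ_pos.le
  rwa [mul_div_cancel₀ _ hp.ρ_pos.ne'] at this

theorem L_eq : p.L = p.κ * p.γ := by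
  rw [κ, div_mul_cancel₀ _ hp.γ_pos.ne']

theorem η_pos : 0 < p.η := div_pos hp.c_pos hp.L_pos

theorem η_mul_L : p.η * p.L = p.c := div_mul_cancel₀ _ hp.L_pos.ne'

theorem η_mul_γ : p.η * p.γ = p.c / p.κ := by
  have := hp.L_pos.ne'
  have := hp.γ_pos.ne'
  rw [η, κ]; field_simp

theorem sqrt_c_pos : 0 < √p.c := Real.sqrt_pos.2 hp.c_pos

theorem sqrt_c_sq : √p.c ^ 2 = p.c := Real.sq_sqrt hp.c_pos.le

theorem sqrt_c_le : √p.c ≤ 1 / 100 := by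
  refine Real.sqrt_le_iff.2 ⟨by norm_num, ?_⟩
  have := hp.c_le
  norm_num at this ⊢
  exact this

theorem r_eq : p.r = √p.c * p.γ / (p.χ ^ 2 * p.κ * p.ρ) := by
  have h1 := hp.γ_pos.ne'
  have h2 := hp.ρ_pos.ne'
  have h3 : p.χ ≠ 0 := by linarith [p.twelve_le_χ]
  have h4 : p.κ ≠ 0 := by linarith [hp.one_le_κ]
  rw [r, hp.L_eq, hp.ε_eq]
  field_simp

theorem r_pos : 0 < p.r := by
  have := hp.γ_pos
  have := hp.ρ_pos
  have := hp.sqrt_c_pos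
  have h3 : 0 < p.χ := by linarith [p.twelve_le_χ]
  have h4 : 0 < p.κ := by linarith [hp.one_le_κ]
  rw [hp.r_eq]
  positivity

theorem gThres_eq : p.gThres = p.L * p.r := by
  have := hp.L_pos.ne'
  rw [gThres, r]; field_simp

theorem gThres_le : p.gThres ≤ p.ε := by
  rw [gThres]
  have h3 := p.twelve_le_χ
  have : √p.c / p.χ ^ 2 ≤ 1 := by
    rw [div_le_one (by positivity)]
    nlinarith [hp.sqrt_c_le]
  nlinarith [hp.ε_pos]

theorem PhiThres_eq : p.PhiThres = p.c / p.χ ^ 3 * (p.γ ^ 3 / p.ρ ^ 2) := by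
  have h1 := hp.γ_pos
  have h2 := hp.ρ_pos
  rw [PhiThres, hp.ε_eq]
  congr 1
  rw [← Real.sqrt_sq (by positivity : 0 ≤ p.γ ^ 3 / p.ρ ^ 2)]
  congr 1
  field_simp

theorem PhiThres_pos : 0 < p.PhiThres := by
  have h1 := hp.γ_pos
  have h2 := hp.ρ_pos
  have h3 := hp.c_pos
  have h4 := p.twelve_le_χ
  rw [hp.PhiThres_eq]
  positivity

theorem L_mul_r_sq_le : p.L * p.r ^ 2 ≤ p.PhiThres / 12 := by
  have h1 := hp.γ_pos
  have h2 := hp.ρ_pos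
  have h3 := hp.c_pos
  have h4 := p.twelve_le_χ
  have h5 := hp.one_le_κ
  have h0 := hp.PhiThres_pos
  have e : p.L * p.r ^ 2 = p.PhiThres / (p.χ * p.κ) := by
    rw [hp.PhiThres_eq, hp.r_eq, hp.L_eq, div_pow, mul_pow, hp.sqrt_c_sq]
    field_simp
  rw [e]
  exact div_le_div_of_nonneg_left h0.le (by norm_num) (by nlinarith)

theorem logFactor_eq : p.logFactor = p.χ := by
  have h1 : (p.d : ℝ) * p.κ ≠ 0 := by
    have := hp.one_le_κ
    have : (1 : ℝ) ≤ p.d := by exact_mod_cast hp.d_pos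
    positivity
  rw [logFactor, δ₁, div_mul_cancel_left₀ h1, ← Real.exp_neg, neg_neg, Real.log_exp]

/-- The smallness assumption on the weight of the `ℓ¹` norm bounds the distance between a proximal
step and a gradient step by an exponentially small fraction of the perturbation radius. -/
theorem mul_sqrt_le {lam chat μ θ : ℝ} (hc : 3 ≤ chat) (hμ : μ ∈ Set.Ioc (0 : ℝ) 1)
    (hθ : θ ∈ Set.Ioo (0 : ℝ) 1) (h : lam < p.lamBound chat μ θ) :
    lam * √p.d ≤ 2 * Real.exp (-3 * p.χ * p.κ) * (p.L * p.r) := by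
  have h1 := hp.γ_pos
  have h2 := hp.ρ_pos
  have h3 := hp.c_pos
  have h4 := p.twelve_le_χ
  have h5 := hp.one_le_κ
  have h6 := hp.L_pos
  have h7 := hp.c_le
  have h8 := hp.r_pos
  set q := (1 - p.η * p.L) ^ (chat * p.timeUnit) with hq
  have hT : p.timeUnit = p.χ * p.κ / p.c := by
    rw [timeUnit, hp.logFactor_eq, hp.η_mul_γ]; field_simp
  have hq0 : 0 < q := Real.rpow_pos_of_pos (by rw [hp.η_mul_L]; linarith) _
  -- The time unit is `χ κ / c` and `1 - c ≤ exp (-c)`, so the power is at most `exp (-chat χ κ)`.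
  have hq1 : q ≤ Real.exp (-3 * p.χ * p.κ) := by
    have e1 : 1 - p.c ≤ Real.exp (-p.c) := by linarith [Real.add_one_le_exp (-p.c)]
    have hT0 : 0 ≤ chat * p.timeUnit := by rw [hT]; positivity
    calc q = (1 - p.c) ^ (chat * p.timeUnit) := by rw [hq, hp.η_mul_L]
      _ ≤ Real.exp (-p.c) ^ (chat * p.timeUnit) :=
        Real.rpow_le_rpow (by linarith) e1 hT0
      _ = Real.exp (-p.c * (chat * p.timeUnit)) := (Real.exp_mul _ _).symm
      _ ≤ _ := by
        refine Real.exp_le_exp.2 ?_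
        have e : -p.c * (chat * p.timeUnit) = -(chat * (p.χ * p.κ)) := by
          rw [hT]; field_simp
        have : 0 ≤ p.χ * p.κ := by positivity
        rw [e]; nlinarith
  have hq2 : q ≤ 1 / 2 := by
    refine hq1.trans ?_
    have e1 : Real.exp (-3 * p.χ * p.κ) ≤ Real.exp (-1) := Real.exp_le_exp.2 (by nlinarith)
    have e2 := Real.exp_one_gt_d9
    rw [Real.exp_neg] at e1
    have e3 : (Real.exp 1)⁻¹ ≤ 2⁻¹ := inv_anti₀ (by norm_num) (by linarith)
    linarith
  -- The bracket in the denominator is at least `1 - q`. Its lower bound `1 / 2` cancels the factor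
  -- `2` in front, and `μ (1 + η γ θ) ≤ 2` supplies the `2` of the statement.
  have hD : 1 / 2 ≤ (1 - p.η * p.L) * (1 - q) + p.η * p.L := by
    rw [hp.η_mul_L]; nlinarith
  have hd : (1 : ℝ) ≤ √p.d := Real.one_le_sqrt.2 (by exact_mod_cast hp.d_pos)
  have hLr : 1 / (p.κ * p.logFactor ^ 2) * √p.η * p.L ^ (3 / 2 : ℝ) * (p.γ / p.ρ)
      = p.L * p.r := by
    have e1 : √p.η * p.L ^ (3 / 2 : ℝ) = √p.c * p.L := by
      rw [η, Real.sqrt_div' _ h6.le, show (3 / 2 : ℝ) = 1 + 1 / 2 by norm_num,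
        Real.rpow_add h6, Real.rpow_one, ← Real.sqrt_eq_rpow]
      have := (Real.sqrt_pos.2 h6).ne'
      field_simp
    rw [mul_assoc (1 / _), e1, hp.logFactor_eq, hp.r_eq]
    field_simp
  have hnum : q * μ * (1 / (p.κ * p.logFactor ^ 2)) * √p.η * p.L ^ (3 / 2 : ℝ) * (p.γ / p.ρ)
      * (1 + p.η * p.γ * θ) ≤ q * (p.L * p.r) * 2 := by
    have e1 : q * μ * (1 / (p.κ * p.logFactor ^ 2)) * √p.η * p.L ^ (3 / 2 : ℝ) * (p.γ / p.ρ)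
      * (1 + p.η * p.γ * θ) = μ * (1 + p.η * p.γ * θ) * (q * (p.L * p.r)) := by
      rw [← hLr]; ring
    have e2 : p.η * p.γ * θ ≤ 1 := by
      rw [hp.η_mul_γ]
      have : p.c / p.κ ≤ 1 := by rw [div_le_one (by positivity)]; linarith
      have : 0 ≤ p.c / p.κ := by positivity
      nlinarith [hθ.1, hθ.2]
    have e3 : 0 ≤ p.η * p.γ * θ := by
      rw [hp.η_mul_γ]
      have := hθ.1
      positivity
    have e4 : μ * (1 + p.η * p.γ * θ) ≤ 2 := by nlinarith [hμ.1, hμ.2]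
    rw [e1, mul_comm _ (2 : ℝ)]
    exact mul_le_mul_of_nonneg_right e4 (by positivity)
  have hbound : lam ≤ q * (p.L * p.r) * 2 / √p.d := by
    refine h.le.trans ?_
    rw [lamBound, ← hq]
    refine div_le_div₀ (by positivity) hnum (by positivity) ?_
    nlinarith
  calc lam * √p.d ≤ q * (p.L * p.r) * 2 / √p.d * √p.d :=
        mul_le_mul_of_nonneg_right hbound (by positivity)
    _ = 2 * q * (p.L * p.r) := by field_simp
    _ ≤ _ := by gcongr

end Admissible
end Params

/-! ### A scalar recursion -/

/-- If a component is multiplied by at least `β` in each step, up to errors that are small relative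
to the full norm, then it grows like `β ^ N`. -/
theorem half_pow_mul_le_of_recursion {a n : ℕ → ℝ} {β μ b s : ℝ} {N : ℕ} (hβ : 1 < β) (hμ : 0 ≤ μ)
    (hb : 0 ≤ b) (hs : 0 < s) (ha0 : a 0 = s) (hn0 : n 0 = s)
    (ha : ∀ t < N, β * a t - μ * n t - b ≤ a (t + 1))
    (hn : ∀ t < N, n (t + 1) ≤ (β + μ) * n t + b)
    (hbs : b / (β - 1) ≤ s / 8) (hpow : (β + μ) ^ N ≤ 5 / 4 * β ^ N) :
    β ^ N * (s / 2) ≤ a N := by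
  -- `b'` is the fixed point of `y ↦ β y - b`; shifting by it removes the additive error from both
  -- recursions.
  set b' := b / (β - 1) with hb'
  have hβ1 : 0 < β - 1 := by linarith
  have hbb : b = b' * (β - 1) := by rw [hb', div_mul_cancel₀ _ hβ1.ne']
  have hb'0 : 0 ≤ b' := by positivity
  have h1 : ∀ t ≤ N, n t + b' ≤ (β + μ) ^ t * (s + b') := by
    intro t
    induction t with
    | zero => intro _; simp [hn0]
    | succ t ih =>
      intro ht
      have h2 := hn t ht
      have h3 := mul_le_mul_of_nonneg_left (ih (by omega)) (by linarith : 0 ≤ β + μ)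
      rw [pow_succ']
      nlinarith
  have h2 : ∀ t ≤ N, β ^ t * (s - b') - ((β + μ) ^ t - β ^ t) * (s + b') ≤ a t - b' := by
    intro t
    induction t with
    | zero => intro _; simp [ha0]
    | succ t ih =>
      intro ht
      have h2 := ha t ht
      have h3 := mul_le_mul_of_nonneg_left (ih (by omega)) (by linarith : 0 ≤ β)
      have h4 := mul_le_mul_of_nonneg_left (h1 t (by omega)) hμ
      rw [pow_succ', pow_succ']
      nlinarith
  -- The constants leave room: `7/8 - (1/4) (9/8) = 19/32 ≥ 1/2`.
  have h3 := h2 N le_rfl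
  have h4 : ((β + μ) ^ N - β ^ N) * (s + b') ≤ (1 / 4 * β ^ N) * (s + s / 8) := by
    have : 0 ≤ (1 / 4 * β ^ N) := by positivity
    refine mul_le_mul (by linarith) (by linarith) (by linarith) this
  have h5 : β ^ N * (s - s / 8) ≤ β ^ N * (s - b') :=
    mul_le_mul_of_nonneg_left (by linarith) (by positivity)
  have h6 : 0 ≤ β ^ N * s := by positivity
  linarith

/-! ### Escaping from a strict saddle point -/

/-- The Hessian at `x` has a direction of curvature below `-γ`. -/
def IsSaddle {d : ℕ} (f : E d → ℝ) (γ : ℝ) (x : E d) : Prop :=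
  ∃ v, ⟪hessian f x v, v⟫ < -γ * ‖v‖ ^ 2

section Iterates

variable {d : ℕ} {f : E d → ℝ} {L ρ lam η : ℝ}

theorem antitone_Phi_iterate (hf : LipschitzAssumption f L ρ) (hη : 0 < η) (hηL : η * L ≤ 1)
    (hl : 0 ≤ lam) (y : E d) : Antitone fun t => Phi f lam ((proxStep f lam η)^[t] y) := by
  refine antitone_nat_of_succ_le fun t => ?_
  rw [Function.iterate_succ_apply']
  have h1 := hf.Phi_proxStep_le hη hηL hl ((proxStep f lam η)^[t] y)
  have : 0 ≤ ‖proxStep f lam η ((proxStep f lam η)^[t] y) - (proxStep f lam η)^[t] y‖ ^ 2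
    / (2 * η) := by positivity
  linarith

/-- Iterates that stay close in objective value stay close in space. -/
theorem norm_iterate_sub_sq_le (hf : LipschitzAssumption f L ρ) (hη : 0 < η) (hηL : η * L ≤ 1)
    (hl : 0 ≤ lam) (y : E d) (t : ℕ) :
    ‖(proxStep f lam η)^[t] y - y‖ ^ 2
      ≤ 2 * η * t * (Phi f lam y - Phi f lam ((proxStep f lam η)^[t] y)) := by
  set z : ℕ → E d := fun t => (proxStep f lam η)^[t] y with hz
  have h1 : ‖z t - y‖ ≤ ∑ i ∈ Finset.range t, dist (z i) (z (i + 1)) := by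
    have := dist_le_range_sum_dist z t
    rwa [dist_comm, dist_eq_norm] at this
  -- Cauchy–Schwarz turns the path length into a sum of squared steps, which telescopes by the
  -- descent inequality.
  have h2 : (∑ i ∈ Finset.range t, dist (z i) (z (i + 1))) ^ 2
      ≤ t * ∑ i ∈ Finset.range t, dist (z i) (z (i + 1)) ^ 2 := by
    simpa using sq_sum_le_card_mul_sum_sq (s := Finset.range t)
      (f := fun i => dist (z i) (z (i + 1)))
  have h3 : ∑ i ∈ Finset.range t, dist (z i) (z (i + 1)) ^ 2
      ≤ 2 * η * (Phi f lam y - Phi f lam (z t)) := by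
    have h4 : ∀ i, dist (z i) (z (i + 1)) ^ 2
        ≤ 2 * η * (Phi f lam (z i) - Phi f lam (z (i + 1))) := by
      intro i
      have h5 := hf.Phi_proxStep_le hη hηL hl (z i)
      have e : z (i + 1) = proxStep f lam η (z i) := Function.iterate_succ_apply' _ _ _
      rw [dist_comm, dist_eq_norm, e, mul_comm, ← div_le_iff₀ (by positivity)]
      linarith
    refine (Finset.sum_le_sum fun i _ => h4 i).trans_eq ?_
    rw [← Finset.mul_sum, Finset.sum_range_sub' (fun i => Phi f lam (z i))]
    rfl
  calc ‖z t - y‖ ^ 2 ≤ (∑ i ∈ Finset.range t, dist (z i) (z (i + 1))) ^ 2 :=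
        pow_le_pow_left₀ (norm_nonneg _) h1 2
    _ ≤ t * (2 * η * (Phi f lam y - Phi f lam (z t))) :=
        h2.trans (mul_le_mul_of_nonneg_left h3 (by positivity))
    _ = _ := by ring

end Iterates

/-! ### Elementary exponential inequalities. -/

section Numerics

/-- For `x ≤ 1 / 100` one has `exp (19 x / 20) ≤ 1 + x`; the loss of a twentieth in the exponent is
harmless later. -/
theorem exp_growth_lower {χ x : ℝ} {N : ℕ} (hx : 0 < x) (hx1 : x ≤ 1 / 100)
    (hN : 2 * χ ≤ x * N) : Real.exp (19 / 10 * χ) ≤ (1 + x) ^ N := by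
  have h1 : Real.exp (19 / 20 * x) ≤ 1 + x := by
    have h2 := Real.add_one_le_exp (-(19 / 20 * x))
    rw [Real.exp_neg] at h2
    have h3 := Real.exp_pos (19 / 20 * x)
    have h4 : (1 - 19 / 20 * x) * Real.exp (19 / 20 * x) ≤ 1 := by
      calc _ ≤ (Real.exp (19 / 20 * x))⁻¹ * Real.exp (19 / 20 * x) :=
            mul_le_mul_of_nonneg_right (by linarith) h3.le
        _ = 1 := inv_mul_cancel₀ h3.ne'
    have h5 : 1 ≤ (1 + x) * (1 - 19 / 20 * x) := by nlinarith
    have h6 : 0 < 1 - 19 / 20 * x := by linarith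
    refine le_of_mul_le_mul_left (h4.trans ?_) h6
    linarith
  calc Real.exp (19 / 10 * χ) ≤ Real.exp (19 / 20 * x * N) :=
        Real.exp_le_exp.2 (by nlinarith)
    _ = Real.exp (19 / 20 * x) ^ N := by rw [← Real.exp_nat_mul]; ring_nf
    _ ≤ _ := pow_le_pow_left₀ (Real.exp_pos _).le h1 N

/-- This is the final contradiction in `Setting.not_both_stuck`; the lower bound `12` for `χ` makes
the fifth-order Taylor term sufficient. -/
theorem mul_lt_exp {χ : ℝ} (hχ : 12 ≤ χ) : 60 * χ < Real.exp (9 / 10 * χ) := by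
  have h1 := Real.pow_div_factorial_le_exp (9 / 10 * χ) (by positivity) 5
  refine lt_of_lt_of_le ?_ h1
  have h2 : (12 : ℝ) ^ 4 ≤ χ ^ 4 := pow_le_pow_left₀ (by norm_num) hχ 4
  have h3 : (12 : ℝ) ^ 4 * χ ≤ χ ^ 4 * χ := mul_le_mul_of_nonneg_right h2 (by positivity)
  have h4 : (Nat.factorial 5 : ℝ) = 120 := by norm_num [Nat.factorial]
  rw [h4, lt_div_iff₀ (by norm_num), mul_pow]
  nlinarith

theorem exp_neg_two_mul_le {χ : ℝ} (hχ : 12 ≤ χ) : 96 * Real.exp (-2 * χ) ≤ 1 := by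
  have h1 := Real.pow_div_factorial_le_exp (2 * χ) (by positivity) 2
  have h2 : (96 : ℝ) ≤ Real.exp (2 * χ) := by
    refine le_trans ?_ h1
    have h4 : (Nat.factorial 2 : ℝ) = 2 := by norm_num [Nat.factorial]
    rw [h4, le_div_iff₀ (by norm_num)]
    nlinarith
  rw [neg_mul, Real.exp_neg, ← div_eq_mul_inv]
  exact div_le_one_of_le₀ h2 (by positivity)

theorem one_add_pow_le {μ : ℝ} {N : ℕ} (hμ : 0 ≤ μ) (h : μ * N ≤ 3 / 20) :
    (1 + μ) ^ N ≤ 5 / 4 := by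
  have h1 : (1 + μ) ^ N ≤ Real.exp (μ * N) := by
    rw [mul_comm, Real.exp_nat_mul]
    exact pow_le_pow_left₀ (by positivity) (by linarith [Real.add_one_le_exp μ]) N
  have h2 : Real.exp (μ * N) ≤ Real.exp (3 / 20) := Real.exp_le_exp.2 h
  have h3 : Real.exp (3 / 20) ≤ 5 / 4 := by
    have h4 := Real.add_one_le_exp (-(3 / 20 : ℝ))
    rw [Real.exp_neg] at h4
    have h5 := inv_anti₀ (by norm_num) h4
    rw [inv_inv] at h5
    exact h5.trans (by norm_num)
  linarith

end Numerics

/-- A common hypothesis: the problem data satisfy the assumptions of the algorithm, and the weight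
of the `ℓ¹` norm is exponentially small. -/
structure Setting (p : Params) (f : E p.d → ℝ) (lam : ℝ) : Prop extends p.Admissible where
  lip : LipschitzAssumption f p.L p.ρ
  lam_nonneg : 0 ≤ lam
  lam_le : lam * √p.d ≤ 2 * Real.exp (-3 * p.χ * p.κ) * (p.L * p.r)

namespace Setting

variable {p : Params} {f : E p.d → ℝ} {lam : ℝ} (hs : Setting p f lam)
include hs

theorem η_mul_L_le : p.η * p.L ≤ 1 := by
  rw [hs.η_mul_L]; linarith [hs.c_le]

theorem lam_le' : lam * √p.d ≤ p.L * p.r / 8 := by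
  refine hs.lam_le.trans ?_
  have h1 := exp_neg_two_mul_le p.twelve_le_χ
  have h2 : Real.exp (-3 * p.χ * p.κ) ≤ Real.exp (-2 * p.χ) :=
    Real.exp_le_exp.2 (by nlinarith [p.twelve_le_χ, hs.one_le_κ])
  have h3 := mul_pos hs.L_pos hs.r_pos
  nlinarith

theorem norm_gradient_le (x : E p.d) :
    ‖gradient f x‖ ≤ ‖gradMap f lam p.η x‖ + lam * √p.d := by
  have hη := hs.η_pos
  have h1 := norm_proxStep_sub_le (f := f) hη.le hs.lam_nonneg x
  have e : x - p.η • gradient f x - proxStep f lam p.η x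
      = p.η • (gradMap f lam p.η x - gradient f x) := by
    rw [gradMap, smul_sub, smul_smul, mul_inv_cancel₀ hη.ne', one_smul]; abel
  rw [e, norm_smul, Real.norm_of_nonneg hη.le, mul_assoc] at h1
  have h2 := le_of_mul_le_mul_left h1 hη
  have h3 := norm_sub_norm_le (gradient f x) (gradMap f lam p.η x)
  rw [norm_sub_rev] at h3
  linarith

/-- A perturbation raises the objective by a small multiple of `L r²`, because `gThres = L r` and
the `ℓ¹` slope is at most `L r / 8`; moreover `12 L r² ≤ PhiThres`. -/
theorem Phi_sub_le_of_norm_le {x u : E p.d} (hx : ‖gradMap f lam p.η x‖ < p.gThres)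
    (hu : ‖u - x‖ ≤ p.r) : Phi f lam u - Phi f lam x ≤ p.PhiThres := by
  have hL := hs.L_pos
  have hr := hs.r_pos
  have h1 := hs.lip.le_quadratic x u
  have h2 := mul_le_mul_of_nonneg_left (l1_sub_l1_le u x) hs.lam_nonneg
  have h3 : ⟪gradient f x, u - x⟫ ≤ (2 * (p.L * p.r)) * p.r := by
    refine (real_inner_le_norm _ _).trans (mul_le_mul ?_ hu (norm_nonneg _) (by positivity))
    have := hs.norm_gradient_le x
    rw [hs.gThres_eq] at hx
    nlinarith [hs.lam_le', mul_pos hL hr]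
  have h4 : ‖u - x‖ ^ 2 ≤ p.r ^ 2 := pow_le_pow_left₀ (norm_nonneg _) hu 2
  have h5 : lam * (√p.d * ‖u - x‖) ≤ p.L * p.r / 8 * p.r := by
    rw [← mul_assoc]
    exact mul_le_mul hs.lam_le' hu (norm_nonneg _) (by positivity)
  have h6 := hs.L_mul_r_sq_le
  have h7 : p.L / 2 * ‖u - x‖ ^ 2 ≤ p.L / 2 * p.r ^ 2 :=
    mul_le_mul_of_nonneg_left h4 (by positivity)
  have h8 := hs.PhiThres_pos
  unfold Phi
  nlinarith

/-- The step count `⌈2 χ κ / c⌉`, long enough for escaping a saddle point and short enough to stay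
localized. -/
theorem escape_steps :
    ∃ N : ℕ, N ≤ p.tThres ∧ 2 * p.χ ≤ p.c / p.κ * N ∧ (N : ℝ) ≤ 3 * (p.χ * p.κ / p.c) := by
  have h3 := hs.c_pos
  have h4 := p.twelve_le_χ
  have h5 := hs.one_le_κ
  have h7 := hs.c_le
  refine ⟨⌈2 * (p.χ * p.κ / p.c)⌉₊, ?_, ?_, ?_⟩
  · rw [p.tThres_eq]
    refine Nat.ceil_mono ?_
    rw [sq, ← div_div, mul_comm, le_div_iff₀ h3]
    have : 0 ≤ p.χ * p.κ / p.c := by positivity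
    nlinarith
  · have := Nat.le_ceil (2 * (p.χ * p.κ / p.c))
    have h8 := mul_le_mul_of_nonneg_left this (by positivity : 0 ≤ p.c / p.κ)
    refine le_trans (le_of_eq ?_) h8
    field_simp
  · have h8 := (Nat.ceil_lt_add_one (by positivity : 0 ≤ 2 * (p.χ * p.κ / p.c))).le
    have : 1 ≤ p.χ * p.κ / p.c := by
      rw [le_div_iff₀ h3]; nlinarith
    linarith

/-- The iterates of a run without sufficient decrease stay within a distance of order
`√c γ / (χ ρ)`. -/
theorem norm_iterate_sub_le {x u : E p.d} (hx : ‖gradMap f lam p.η x‖ < p.gThres)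
    (hu : ‖u - x‖ ≤ p.r)
    (hstuck : -p.PhiThres < Phi f lam ((proxStep f lam p.η)^[p.tThres] u) - Phi f lam x)
    {t : ℕ} (ht : t ≤ p.tThres) (htN : (t : ℝ) ≤ 3 * (p.χ * p.κ / p.c)) :
    ‖(proxStep f lam p.η)^[t] u - x‖ ≤ 5 * (√p.c * p.γ / (p.χ * p.ρ)) := by
  have h1 := hs.γ_pos
  have h2 := hs.ρ_pos
  have h3 := hs.c_pos
  have h4 := p.twelve_le_χ
  have h5 := hs.one_le_κ
  have h6 := hs.sqrt_c_pos
  have h0 := hs.PhiThres_pos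
  have hη := hs.η_pos
  have h7 := norm_iterate_sub_sq_le hs.lip hs.η_pos hs.η_mul_L_le hs.lam_nonneg u t
  have h8 := antitone_Phi_iterate hs.lip hs.η_pos hs.η_mul_L_le hs.lam_nonneg u ht
  have h9 := hs.Phi_sub_le_of_norm_le hx hu
  have h10 : ‖(proxStep f lam p.η)^[t] u - u‖ ^ 2 ≤ (4 * (√p.c * p.γ / (p.χ * p.ρ))) ^ 2 := by
    -- The perturbation adds at most one `PhiThres` and a stuck run loses less than another;
    -- monotonicity carries this to every `t ≤ tThres`.
    have e1 : Phi f lam u - Phi f lam ((proxStep f lam p.η)^[t] u) ≤ 2 * p.PhiThres := by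
      simp only at h8
      linarith
    calc _ ≤ 2 * p.η * t * (2 * p.PhiThres) :=
          h7.trans (mul_le_mul_of_nonneg_left e1 (by positivity))
      _ ≤ 2 * p.η * (3 * (p.χ * p.κ / p.c)) * (2 * p.PhiThres) := by gcongr
      _ = 12 * (p.c * p.γ ^ 2 / (p.χ ^ 2 * p.ρ ^ 2)) := by
        have e2 : p.η = p.c / (p.κ * p.γ) := by rw [Params.η, ← hs.L_eq]
        rw [e2, hs.PhiThres_eq]
        field_simp
        norm_num
      _ ≤ 16 * (p.c * p.γ ^ 2 / (p.χ ^ 2 * p.ρ ^ 2)) := by gcongr; norm_num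
      _ = _ := by
        rw [mul_pow, div_pow, mul_pow, hs.sqrt_c_sq]; ring
  have h11 := abs_le_of_sq_le_sq h10 (by positivity)
  rw [abs_of_nonneg (norm_nonneg _)] at h11
  have h12 : p.r ≤ √p.c * p.γ / (p.χ * p.ρ) := by
    rw [hs.r_eq]
    refine div_le_div_of_nonneg_left (by positivity) (by positivity) ?_
    have : p.χ * p.ρ * 1 ≤ p.χ * p.ρ * (p.χ * p.κ) :=
      mul_le_mul_of_nonneg_left (by nlinarith) (by positivity)
    nlinarith
  have h13 := norm_add_le ((proxStep f lam p.η)^[t] u - u) (u - x)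
  rw [sub_add_sub_cancel] at h13
  linarith

theorem exists_escape_direction {x : E p.d} (hx : IsSaddle f p.γ x) :
    ∃ (a : ℝ) (e : E p.d), ‖e‖ = 1 ∧ hessian f x e = a • e ∧ a < -p.γ ∧
      ∀ v, ‖v - p.η • hessian f x v‖ ≤ (1 - p.η * a) * ‖v‖ := by
  obtain ⟨a, e, he, hHe, hmin, -, hstep⟩ := exists_min_eigenvector hs.d_pos (hessian f x)
    (hs.lip.inner_hessian_comm x) (hs.lip.norm_hessian_le hs.L_pos.le x)
  refine ⟨a, e, he, hHe, ?_, hstep p.η hs.η_pos.le hs.η_mul_L_le⟩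
  obtain ⟨v, hv⟩ := hx
  have h1 := (hmin v).trans_lt hv
  have h2 : 0 < ‖v‖ ^ 2 := by
    rcases (sq_nonneg ‖v‖).eq_or_lt with h | h
    · rw [← h] at h1; simp at h1
    · exact h
  exact lt_of_mul_lt_mul_right h1 h2.le

/-- Here the exponential smallness of `lam` enters: the accumulated `ℓ¹` error must stay below an
eighth of the smallest separation considered, which is itself of order `exp (-χ)`. -/
theorem prox_error_le :
    2 * (p.η * lam * √p.d) / (p.c / p.κ) ≤ p.r * p.κ * Real.exp (-p.χ) / 3 / 8 := by
  have h3 := hs.c_pos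
  have h4 := p.twelve_le_χ
  have h5 := hs.one_le_κ
  have hη := hs.η_pos
  have hr := hs.r_pos
  have hexp := Real.exp_pos (-p.χ)
  rw [div_le_iff₀ (by positivity)]
  have g2 : 2 * (p.η * lam * √p.d) ≤ 4 * p.c * Real.exp (-3 * p.χ * p.κ) * p.r := by
    have := mul_le_mul_of_nonneg_left hs.lam_le (by positivity : 0 ≤ 2 * p.η)
    calc 2 * (p.η * lam * √p.d) = 2 * p.η * (lam * √p.d) := by ring
      _ ≤ _ := this
      _ = 4 * (p.η * p.L) * Real.exp (-3 * p.χ * p.κ) * p.r := by ring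
      _ = _ := by rw [hs.η_mul_L]
  have g3 : Real.exp (-3 * p.χ * p.κ) ≤ Real.exp (-2 * p.χ) * Real.exp (-p.χ) := by
    rw [← Real.exp_add]
    have hχκ : p.χ * 1 ≤ p.χ * p.κ := mul_le_mul_of_nonneg_left h5 (by linarith)
    exact Real.exp_le_exp.2 (by linarith)
  have g4 := exp_neg_two_mul_le h4
  have g5 : 4 * Real.exp (-3 * p.χ * p.κ) ≤ Real.exp (-p.χ) / 24 := by
    have := mul_le_mul_of_nonneg_right g4 hexp.le
    linarith
  have g6 : p.r * p.κ * Real.exp (-p.χ) / 3 / 8 * (p.c / p.κ)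
      = p.r * Real.exp (-p.χ) / 24 * p.c := by field_simp; norm_num
  rw [g6]
  refine g2.trans ?_
  have := mul_le_mul_of_nonneg_right g5 (by positivity : 0 ≤ p.c * p.r)
  linarith

/-- The relative linearization error accumulated over all escape steps is `15 √c`, which is small
because `c ≤ 1 / 10000`. -/
theorem hessian_error_le :
    p.η * (p.ρ * (5 * (√p.c * p.γ / (p.χ * p.ρ)))) * (3 * (p.χ * p.κ / p.c)) ≤ 3 / 20 := by
  have h1 := hs.γ_pos
  have h2 := hs.ρ_pos
  have h3 := hs.c_pos
  have h4 := p.twelve_le_χ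
  have h5 := hs.one_le_κ
  have e1 : p.η * (p.ρ * (5 * (√p.c * p.γ / (p.χ * p.ρ)))) * (3 * (p.χ * p.κ / p.c))
      = 15 * √p.c := by
    have e2 : p.η = p.c / (p.κ * p.γ) := by rw [Params.η, ← hs.L_eq]
    rw [e2]
    field_simp
    norm_num
  rw [e1]
  linarith [hs.sqrt_c_le]

set_option maxHeartbeats 1000000 in
/-- Of two starting points near a saddle point that differ along the escape direction, at least one
leads to a sufficient decrease of the objective. -/
theorem not_both_stuck {x e u : E p.d} {a s : ℝ} (hx : ‖gradMap f lam p.η x‖ < p.gThres)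
    (he : ‖e‖ = 1) (hHe : hessian f x e = a • e) (ha : a < -p.γ)
    (hstep : ∀ v, ‖v - p.η • hessian f x v‖ ≤ (1 - p.η * a) * ‖v‖)
    (hu : ‖u - x‖ ≤ p.r) (hw : ‖u + s • e - x‖ ≤ p.r)
    (hsr : p.r * p.κ * Real.exp (-p.χ) / 3 ≤ s)
    (hsu : -p.PhiThres < Phi f lam ((proxStep f lam p.η)^[p.tThres] u) - Phi f lam x)
    (hsw : -p.PhiThres < Phi f lam ((proxStep f lam p.η)^[p.tThres] (u + s • e)) - Phi f lam x) :
    False := by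
  have h1 := hs.γ_pos
  have h2 := hs.ρ_pos
  have h3 := hs.c_pos
  have h4 := p.twelve_le_χ
  have h5 := hs.one_le_κ
  have h6 := hs.sqrt_c_pos
  have hη := hs.η_pos
  have hr := hs.r_pos
  have hL := hs.L_pos
  have hl := hs.lam_nonneg
  have hexp := Real.exp_pos (-p.χ)
  obtain ⟨N, hNT, hN2, hN3⟩ := hs.escape_steps
  set R := 5 * (√p.c * p.γ / (p.χ * p.ρ)) with hR
  have hR0 : 0 < R := by positivity
  set U : ℕ → E p.d := fun t => (proxStep f lam p.η)^[t] u with hU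
  set W : ℕ → E p.d := fun t => (proxStep f lam p.η)^[t] (u + s • e) with hW
  have hUR : ∀ t ≤ N, ‖U t - x‖ ≤ R := fun t ht =>
    hs.norm_iterate_sub_le hx hu hsu (ht.trans hNT) ((Nat.cast_le.2 ht).trans hN3)
  have hWR : ∀ t ≤ N, ‖W t - x‖ ≤ R := fun t ht =>
    hs.norm_iterate_sub_le hx hw hsw (ht.trans hNT) ((Nat.cast_le.2 ht).trans hN3)
  set μ := p.η * (p.ρ * R) with hμ
  set b := 2 * (p.η * lam * √p.d) with hb
  set β := 1 - p.η * a with hβ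
  have hβγ : 1 + p.c / p.κ ≤ β := by
    rw [hβ, ← hs.η_mul_γ]; nlinarith
  have hcκ : 0 < p.c / p.κ := by positivity
  have hμ0 : 0 ≤ μ := by positivity
  have hb0 : 0 ≤ b := by positivity
  have hs0 : 0 < s := lt_of_lt_of_le (by positivity) hsr
  -- the error of the linearized recursion
  have herr : ∀ t < N, ‖(W (t + 1) - U (t + 1)) -
      ((W t - U t) - p.η • hessian f x (W t - U t))‖ ≤ μ * ‖W t - U t‖ + b := by
    intro t ht
    have hU1 : U (t + 1) = proxStep f lam p.η (U t) := Function.iterate_succ_apply' _ _ _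
    have hW1 : W (t + 1) = proxStep f lam p.η (W t) := Function.iterate_succ_apply' _ _ _
    have g1 := norm_proxStep_sub_le (f := f) hη.le hl (U t)
    have g2 := norm_proxStep_sub_le (f := f) hη.le hl (W t)
    have g3 := hs.lip.norm_gradient_sub_sub_le h2.le (hUR t ht.le) (hWR t ht.le)
    have e1 : (W (t + 1) - U (t + 1)) - ((W t - U t) - p.η • hessian f x (W t - U t))
        = (U t - p.η • gradient f (U t) - U (t + 1)) - (W t - p.η • gradient f (W t) - W (t + 1))
          - p.η • (gradient f (W t) - gradient f (U t) - hessian f x (W t - U t)) := by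
      simp only [smul_sub]; abel
    rw [e1]
    refine (norm_sub_le _ _).trans ?_
    have g4 := norm_sub_le (U t - p.η • gradient f (U t) - U (t + 1))
      (W t - p.η • gradient f (W t) - W (t + 1))
    rw [← hU1] at g1
    rw [← hW1] at g2
    rw [norm_smul, Real.norm_of_nonneg hη.le]
    have g5 := mul_le_mul_of_nonneg_left g3 hη.le
    rw [hμ, hb]
    linarith
  -- Track the component along `e` and the full norm. By `hstep` the norm grows no faster than `β +
  -- μ` apart from `b`, so the error `μ ‖W t - U t‖` cannot overtake the component.
  have hrec := half_pow_mul_le_of_recursion (a := fun t => ⟪W t - U t, e⟫)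
    (n := fun t => ‖W t - U t‖) (β := β) (μ := μ) (b := b) (s := s) (N := N) (by linarith) hμ0 hb0
    hs0 ?_ ?_ ?_ ?_ ?_ ?_
  · -- the separation contradicts the localization
    have hlow : Real.exp (19 / 10 * p.χ) ≤ β ^ N :=
      (exp_growth_lower hcκ (by
        rw [div_le_iff₀ (by positivity)]; nlinarith [hs.c_le]) hN2).trans
        (pow_le_pow_left₀ (by positivity) hβγ N)
    have hup : ⟪W N - U N, e⟫ ≤ 2 * R := by
      refine (real_inner_le_norm _ _).trans ?_
      rw [he, mul_one]
      have := norm_sub_le (W N - x) (U N - x)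
      rw [sub_sub_sub_cancel_right] at this
      linarith [hUR N le_rfl, hWR N le_rfl]
    -- In units of `r κ` the comparison becomes `exp (9 χ / 10) ≤ 60 χ`, which is false for `χ ≥
    -- 12`.
    have hRr : R = 5 * (p.χ * p.κ) * p.r := by
      rw [hR, hs.r_eq]; field_simp
    have g1 : Real.exp (19 / 10 * p.χ) * (p.r * p.κ * Real.exp (-p.χ) / 6) ≤ 2 * R := by
      refine le_trans (mul_le_mul hlow ?_ (by positivity)
        (pow_nonneg (by linarith) N)) (hrec.trans hup)
      linarith
    have g2 : Real.exp (19 / 10 * p.χ) * (p.r * p.κ * Real.exp (-p.χ) / 6)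
        = Real.exp (9 / 10 * p.χ) * (p.r * p.κ / 6) := by
      have : Real.exp (9 / 10 * p.χ) = Real.exp (19 / 10 * p.χ) * Real.exp (-p.χ) := by
        rw [← Real.exp_add]; ring_nf
      rw [this]; ring
    rw [g2, hRr] at g1
    have g3 := mul_lt_exp h4
    have g4 : 0 < p.r * p.κ / 6 := by positivity
    have g5 := mul_lt_mul_of_pos_right g3 g4
    nlinarith
  · simp [hU, hW, inner_smul_left, he]
  · simp [hU, hW, norm_smul, he, abs_of_pos hs0]
  · intro t ht
    have g1 := herr t ht
    have g2 : ⟪(W t - U t) - p.η • hessian f x (W t - U t), e⟫ = β * ⟪W t - U t, e⟫ := by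
      rw [inner_sub_left, inner_smul_left, hs.lip.inner_hessian_comm, hHe, inner_smul_right, hβ]
      simp; ring
    have g3 := (abs_le.1 ((abs_real_inner_le_norm ((W (t + 1) - U (t + 1)) -
      ((W t - U t) - p.η • hessian f x (W t - U t))) e).trans (by rw [he, mul_one]))).1
    rw [inner_sub_left, g2] at g3
    linarith
  · intro t ht
    have g1 := herr t ht
    have g2 := hstep (W t - U t)
    have g3 := norm_add_le ((W (t + 1) - U (t + 1)) -
      ((W t - U t) - p.η • hessian f x (W t - U t)))
      ((W t - U t) - p.η • hessian f x (W t - U t))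
    rw [sub_add_cancel] at g3
    linarith
  · have g1 : b / (β - 1) ≤ b / (p.c / p.κ) :=
      div_le_div_of_nonneg_left hb0 hcκ (by linarith)
    have := hs.prox_error_le
    linarith
  · have g1 : β + μ ≤ β * (1 + μ) := by
      have : μ ≤ β * μ := le_mul_of_one_le_left hμ0 (by linarith)
      linarith
    have g2 : (1 + μ) ^ N ≤ 5 / 4 :=
      one_add_pow_le hμ0 ((mul_le_mul_of_nonneg_left hN3 hμ0).trans hs.hessian_error_le)
    have hβ0 : 0 ≤ β := by linarith
    calc (β + μ) ^ N ≤ (β * (1 + μ)) ^ N := pow_le_pow_left₀ (by linarith) g1 N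
      _ = β ^ N * (1 + μ) ^ N := mul_pow _ _ _
      _ ≤ β ^ N * (5 / 4) := mul_le_mul_of_nonneg_left g2 (pow_nonneg hβ0 N)
      _ = _ := mul_comm _ _

/-- At a saddle point the objective exceeds its infimum by at least the decrease threshold. -/
theorem exists_Phi_le_of_isSaddle {x : E p.d} (hx : IsSaddle f p.γ x) :
    ∃ y, Phi f lam y ≤ Phi f lam x - p.PhiThres := by
  have h1 := hs.γ_pos
  have h2 := hs.ρ_pos
  have h4 := p.twelve_le_χ
  obtain ⟨a, e, he, hHe, ha, -⟩ := hs.exists_escape_direction hx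
  -- Orient the eigenvector so that the first-order term does not increase `f`.
  obtain ⟨v, hv, hHv, hgv⟩ : ∃ v : E p.d, ‖v‖ = 1 ∧ hessian f x v = a • v ∧
      ⟪gradient f x, v⟫ ≤ 0 := by
    rcases le_total ⟪gradient f x, e⟫ 0 with h | h
    · exact ⟨e, he, hHe, h⟩
    · exact ⟨-e, by rwa [norm_neg], by rw [map_neg, hHe, smul_neg], by
        rw [inner_neg_right]; linarith⟩
  -- With step length `γ / ρ` the cubic bound `-γ S² / 2 + ρ S³ / 3` equals `-γ³ / (6 ρ²)`, which
  -- dominates both the `ℓ¹` increase and `PhiThres`.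
  have hS : 0 ≤ p.γ / p.ρ := by positivity
  have h5 := hs.lip.line_le x v (S := p.γ / p.ρ) (a := 0) (b := -p.γ) (k := p.ρ) hS
    fun s hs0 _ => ?_
  · refine ⟨x + (p.γ / p.ρ) • v, ?_⟩
    have h6 := mul_le_mul_of_nonneg_left (l1_sub_l1_le (x + (p.γ / p.ρ) • v) x) hs.lam_nonneg
    rw [add_sub_cancel_left, norm_smul, hv, mul_one, Real.norm_of_nonneg hS, ← mul_assoc] at h6
    have h7 := mul_le_mul_of_nonneg_right hs.lam_le' hS
    set D := p.γ ^ 3 / p.ρ ^ 2 with hD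
    have hD0 : 0 < D := by positivity
    have h8 : p.L * p.r / 8 * (p.γ / p.ρ) = √p.c / p.χ ^ 2 / 8 * D := by
      have := hs.one_le_κ
      rw [hs.r_eq, hs.L_eq, hD]
      field_simp
    have h9 : 0 * (p.γ / p.ρ) + -p.γ * (p.γ / p.ρ) ^ 2 / 2 + p.ρ * (p.γ / p.ρ) ^ 3 / 3
        = -D / 6 := by
      rw [hD]; field_simp; ring
    have h10 : √p.c / p.χ ^ 2 ≤ 1 / 100 := by
      rw [div_le_iff₀ (by positivity)]
      nlinarith [hs.sqrt_c_le]
    have h11 : p.c / p.χ ^ 3 ≤ 1 / 100 := by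
      rw [div_le_iff₀ (by positivity)]
      have : 1 ≤ p.χ ^ 3 := one_le_pow₀ (by linarith)
      nlinarith [hs.c_le]
    rw [h8] at h7
    rw [h9] at h5
    rw [hs.PhiThres_eq]
    unfold Phi
    nlinarith
  · have h6 := hs.lip.norm_gradient_sub_sub_le h2.le (x := x) (u := x) (w := x + s • v) (R := s)
      (by simpa using hs0) (by simp [norm_smul, hv, abs_of_nonneg hs0])
    rw [add_sub_cancel_left, norm_smul, hv, mul_one, Real.norm_of_nonneg hs0, map_smul, hHv] at h6
    have h7 : ⟪gradient f (x + s • v) - gradient f x - s • a • v, v⟫ ≤ p.ρ * s * s := by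
      refine (real_inner_le_norm _ _).trans ?_
      rwa [hv, mul_one]
    rw [inner_sub_left, inner_sub_left, inner_smul_left, inner_smul_left,
      real_inner_self_eq_norm_sq, hv] at h7
    simp only [conj_trivial, one_pow, mul_one] at h7
    nlinarith

end Setting

/-! ### The volume of thin sets -/

theorem one_add_inv_pow_le {d : ℕ} (hd : 1 ≤ d) : (1 + 1 / (d : ℝ)) ^ d ≤ 3 := by
  have hd0 : (0 : ℝ) < d := by exact_mod_cast hd
  have h1 : 1 + 1 / (d : ℝ) ≤ Real.exp (1 / d) := by linarith [Real.add_one_le_exp (1 / (d : ℝ))]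
  calc (1 + 1 / (d : ℝ)) ^ d ≤ Real.exp (1 / d) ^ d := pow_le_pow_left₀ (by positivity) h1 d
    _ = Real.exp 1 := by rw [← Real.exp_nat_mul]; congr 1; field_simp
    _ ≤ 3 := by linarith [Real.exp_one_lt_d9]

/-- A subset of a ball that meets each line in a given direction in a set of diameter at most `w`
occupies at most a fraction `3 d w / r` of the ball. -/
theorem volume_le_of_thin {d : ℕ} (hd : 1 ≤ d) {r w : ℝ} (hr : 0 < r) (hw : 0 < w) {A : Set (E d)}
    (hA : MeasurableSet A) (hAr : A ⊆ Metric.closedBall 0 r) {e : E d} (he : ‖e‖ = 1)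
    (hthin : ∀ x ∈ A, ∀ s, w ≤ s → x + s • e ∉ A) :
    volume A ≤ ENNReal.ofReal (3 * d * w / r) * volume (Metric.closedBall (0 : E d) r) := by
  have hd0 : (0 : ℝ) < d := by exact_mod_cast hd
  -- The translates of `A` by `k w e`, `k ≤ m`, are disjoint and lie in a ball of radius at most `r
  -- (1 + 1 / d)`, whose volume is at most `3` times the original. Dividing by `m + 1 ≥ r / (d w)`
  -- avoids any computation of sections of the ball.
  set m := ⌊r / (d * w)⌋₊ with hm
  set T : ℕ → Set (E d) := fun k => (fun x => x + (-(k * w)) • e) ⁻¹' A with hT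
  have hTm : ∀ k, MeasurableSet (T k) := fun k => hA.preimage (by fun_prop)
  have hTv : ∀ k, volume (T k) = volume A := fun k => measure_preimage_add_right _ _ _
  have hTd : Pairwise (Function.onFun Disjoint T) := by
    have key : ∀ i j, i < j → Disjoint (T i) (T j) := by
      intro i j hij
      rw [Set.disjoint_left]
      intro x hi hj
      refine hthin _ hj ((j - i) * w) ?_ ?_
      · have : (i : ℝ) + 1 ≤ j := by exact_mod_cast hij
        nlinarith
      · have e1 : x + (-(j * w)) • e + ((j - i : ℝ) * w) • e = x + (-(i * w)) • e := by
          rw [add_assoc, ← add_smul]; ring_nf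
        rw [e1]; exact hi
    intro i j hij
    rcases lt_or_gt_of_ne hij with h | h
    · exact key i j h
    · exact (key j i h).symm
  have hTr : ⋃ k ∈ Finset.range (m + 1), T k ⊆ Metric.closedBall 0 (r + m * w) := by
    refine Set.iUnion₂_subset fun k hk x hx => ?_
    have h1 := hAr hx
    rw [mem_closedBall_zero_iff] at h1 ⊢
    have h2 := norm_sub_le (x + (-(k * w)) • e) ((-(k * w)) • e)
    rw [add_sub_cancel_right, norm_smul, he, mul_one, norm_neg,
      Real.norm_of_nonneg (by positivity)] at h2
    have h3 : (k : ℝ) ≤ m := by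
      have := Finset.mem_range.1 hk
      exact_mod_cast Nat.lt_succ_iff.1 this
    nlinarith
  have hsum : ((m + 1 : ℕ) : ENNReal) * volume A
      ≤ ENNReal.ofReal 3 * volume (Metric.closedBall (0 : E d) r) := by
    calc ((m + 1 : ℕ) : ENNReal) * volume A = ∑ k ∈ Finset.range (m + 1), volume (T k) := by
          simp [hTv]
      _ = volume (⋃ k ∈ Finset.range (m + 1), T k) :=
          (measure_biUnion_finset (fun i _ j _ hij => hTd hij) fun k _ => hTm k).symm
      _ ≤ volume (Metric.closedBall (0 : E d) (r + m * w)) := measure_mono hTr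
      _ ≤ _ := by
        rw [Measure.addHaar_closedBall _ _ (by positivity), Measure.addHaar_closedBall _ _ hr.le,
          ← mul_assoc, ← ENNReal.ofReal_mul (by norm_num)]
        gcongr
        rw [finrank_euclideanSpace_fin]
        have h1 : m * w ≤ r * (1 / d) := by
          have := Nat.floor_le (by positivity : 0 ≤ r / (d * w))
          rw [← hm, le_div_iff₀ (by positivity)] at this
          rw [mul_one_div, le_div_iff₀ hd0]
          linarith
        calc (r + m * w) ^ d ≤ (r * (1 + 1 / d)) ^ d :=
              pow_le_pow_left₀ (by positivity) (by linarith) d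
          _ = r ^ d * (1 + 1 / d) ^ d := mul_pow _ _ _
          _ ≤ r ^ d * 3 := mul_le_mul_of_nonneg_left (one_add_inv_pow_le hd) (by positivity)
          _ = _ := mul_comm _ _
  have hone : (1 : ENNReal) ≤ ENNReal.ofReal (d * w / r) * ((m + 1 : ℕ) : ENNReal) := by
    rw [← ENNReal.ofReal_natCast, ← ENNReal.ofReal_mul (by positivity), ← ENNReal.ofReal_one]
    refine ENNReal.ofReal_le_ofReal ?_
    have := (Nat.lt_floor_add_one (r / (d * w))).le
    rw [← hm, div_le_iff₀ (by positivity)] at this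
    rw [div_mul_eq_mul_div, le_div_iff₀ hr]
    push_cast
    linarith
  calc volume A = 1 * volume A := (one_mul _).symm
    _ ≤ ENNReal.ofReal (d * w / r) * ((m + 1 : ℕ) : ENNReal) * volume A := by gcongr
    _ = ENNReal.ofReal (d * w / r) * (((m + 1 : ℕ) : ENNReal) * volume A) := mul_assoc _ _ _
    _ ≤ ENNReal.ofReal (d * w / r) *
        (ENNReal.ofReal 3 * volume (Metric.closedBall (0 : E d) r)) := by gcongr
    _ = _ := by
      rw [← mul_assoc, ← ENNReal.ofReal_mul (by positivity)]
      congr 2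
      ring

/-- Starting from `u`, the objective does not decrease sufficiently below its value at `x` within
`tThres` proximal steps. -/
def Stuck (p : Params) (f : E p.d → ℝ) (lam : ℝ) (x u : E p.d) : Prop :=
  -p.PhiThres < Phi f lam ((proxStep f lam p.η)^[p.tThres] u) - Phi f lam x

namespace Setting

variable {p : Params} {f : E p.d → ℝ} {lam : ℝ} (hs : Setting p f lam)
include hs

/-- Joint openness in base point and perturbation provides the measurability needed for the product
measure; it rests on the strict inequality in `Stuck`. -/
theorem isOpen_stuck : IsOpen {q : E p.d × E p.d | Stuck p f lam q.1 (q.1 + q.2)} := by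
  have h1 := hs.lip.continuous_Phi lam
  have h2 := (hs.lip.continuous_proxStep hs.η_pos.le hs.lam_nonneg).iterate p.tThres
  unfold Stuck
  exact isOpen_lt continuous_const (by fun_prop)

/-- A uniform perturbation of a saddle point fails to escape with probability at most `δ₁`. -/
theorem volume_stuck_le {x : E p.d} (hx : ‖gradMap f lam p.η x‖ < p.gThres)
    (hsad : IsSaddle f p.γ x) :
    volume (Metric.closedBall 0 p.r ∩ {z | Stuck p f lam x (x + z)})
      ≤ ENNReal.ofReal p.δ₁ * volume (Metric.closedBall (0 : E p.d) p.r) := by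
  obtain ⟨a, e, he, hHe, ha, hstep⟩ := hs.exists_escape_direction hsad
  have hr := hs.r_pos
  have hκ := hs.one_le_κ
  -- With this width the fraction `3 d w / r` is exactly `δ₁`.
  have hw : 0 < p.r * p.κ * Real.exp (-p.χ) / 3 := by positivity
  have hm : MeasurableSet {z | Stuck p f lam x (x + z)} :=
    (hs.isOpen_stuck.preimage (by fun_prop : Continuous fun z : E p.d => (x, z))).measurableSet
  have h := volume_le_of_thin hs.d_pos hr hw (measurableSet_closedBall.inter hm)
    Set.inter_subset_left he fun z hz s hsw hz' => ?_
  · refine h.trans_eq ?_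
    congr 2
    rw [Params.δ₁]; field_simp
  · have h1 := hz.1
    have h2 := hz'.1
    rw [mem_closedBall_zero_iff] at h1 h2
    refine hs.not_both_stuck hx he hHe ha hstep (u := x + z) (s := s) ?_ ?_ hsw hz.2 ?_
    · rwa [add_sub_cancel_left]
    · rwa [add_assoc, add_sub_cancel_left]
    · have := hz'.2
      rwa [Set.mem_ofPred_eq, ← add_assoc] at this

end Setting

/-! ### Runs of the algorithm -/

section Run

variable (p : Params) (f : E p.d → ℝ) (lam : ℝ) (x₀ : E p.d) (ξ : ℕ → E p.d)

/-- The iterate is perturbed in iteration `t`. -/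
def IsPerturbation (t : ℕ) : Prop :=
  (run p f lam x₀ ξ t).output = none ∧ ‖gradMap f lam p.η (run p f lam x₀ ξ t).x‖ < p.gThres ∧
    (p.tThres : ℤ) < (t : ℤ) - (run p f lam x₀ ξ t).tNoise

/-- A saddle point is perturbed in iteration `t`. -/
def IsSaddlePerturbation (t : ℕ) : Prop :=
  IsPerturbation p f lam x₀ ξ t ∧ IsSaddle f p.γ (run p f lam x₀ ξ t).x

open Classical in
/-- The number of perturbations of saddle points during the first `n` iterations. -/
def saddleCount (n : ℕ) : ℕ := Nat.count (IsSaddlePerturbation p f lam x₀ ξ) n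

/-- The objective is below its initial value by the decrease due to `k` proximal steps at points
with a large gradient mapping and to `m` escapes. -/
def PhiBelow (k m : ℕ) (x : E p.d) : Prop :=
  Phi f lam x ≤ Phi f lam x₀ - k * (p.η / 2 * p.gThres ^ 2) - m * p.PhiThres

open Classical in
/-- The phases of a run at the beginning of iteration `n`: a phase of plain proximal steps, the
waiting time of `j` iterations after a perturbation, or the time after the return. -/
inductive RunPhase (n : ℕ) : Prop
  | free (k m : ℕ) (hout : (run p f lam x₀ ξ n).output = none)
      (hwait : (p.tThres : ℤ) < (n : ℤ) - (run p f lam x₀ ξ n).tNoise)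
      (hn : n = k + m * (p.tThres + 1)) (hPhi : PhiBelow p f lam x₀ k m (run p f lam x₀ ξ n).x)
      (hcount : saddleCount p f lam x₀ ξ n ≤ m)
  | waiting (k m τ j : ℕ) (hout : (run p f lam x₀ ξ n).output = none) (hj : 1 ≤ j)
      (hjT : j ≤ p.tThres) (hn : n = τ + j) (hτ : τ = k + m * (p.tThres + 1))
      (hnoise : (run p f lam x₀ ξ n).tNoise = τ) (hpert : IsPerturbation p f lam x₀ ξ τ)
      (hanchor : (run p f lam x₀ ξ n).anchor = (run p f lam x₀ ξ τ).x)
      (hx : (run p f lam x₀ ξ n).x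
        = (proxStep f lam p.η)^[j] ((run p f lam x₀ ξ τ).x + ξ τ))
      (hPhi : PhiBelow p f lam x₀ k m (run p f lam x₀ ξ τ).x)
      (hcount : saddleCount p f lam x₀ ξ n
        ≤ m + if IsSaddle f p.γ (run p f lam x₀ ξ τ).x then 1 else 0)
  | done (k m τ : ℕ) (hτ : τ < n) (hpert : IsPerturbation p f lam x₀ ξ τ)
      (hout : (run p f lam x₀ ξ n).output = some (run p f lam x₀ ξ τ).x)
      (hstuck : Stuck p f lam (run p f lam x₀ ξ τ).x ((run p f lam x₀ ξ τ).x + ξ τ))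
      (hPhi : PhiBelow p f lam x₀ k m (run p f lam x₀ ξ τ).x)
      (hcount : saddleCount p f lam x₀ ξ n
        ≤ m + if IsSaddle f p.γ (run p f lam x₀ ξ τ).x then 1 else 0)

end Run

section

variable {p : Params} {f : E p.d → ℝ} {lam : ℝ} {x₀ : E p.d} {ξ : ℕ → E p.d}

theorem run_succ_of_none {n : ℕ} (h : (run p f lam x₀ ξ n).output = none) :
    run p f lam x₀ ξ (n + 1)
      = returnOrDescend p f lam n (perturb p f lam n (ξ n) (run p f lam x₀ ξ n)) := by
  rw [run, iteration, h]

theorem run_succ_of_some {n : ℕ} {y : E p.d} (h : (run p f lam x₀ ξ n).output = some y) :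
    run p f lam x₀ ξ (n + 1) = run p f lam x₀ ξ n := by
  rw [run, iteration, h]

open Classical in
theorem saddleCount_succ (n : ℕ) : saddleCount p f lam x₀ ξ (n + 1)
    = saddleCount p f lam x₀ ξ n + if IsSaddlePerturbation p f lam x₀ ξ n then 1 else 0 := by
  unfold saddleCount
  rw [Nat.count_succ]

theorem saddleCount_succ_of_not {n : ℕ} (h : ¬ IsPerturbation p f lam x₀ ξ n) :
    saddleCount p f lam x₀ ξ (n + 1) = saddleCount p f lam x₀ ξ n := by
  rw [saddleCount_succ, if_neg fun h' => h h'.1, add_zero]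

theorem run_succ_of_isPerturbation (hT : 1 ≤ p.tThres) {n : ℕ}
    (h : IsPerturbation p f lam x₀ ξ n) :
    run p f lam x₀ ξ (n + 1) =
      { x := proxStep f lam p.η ((run p f lam x₀ ξ n).x + ξ n)
        anchor := (run p f lam x₀ ξ n).x
        tNoise := n
        output := none } := by
  rw [run_succ_of_none h.1, perturb, if_pos h.2, returnOrDescend, if_neg, h.1]
  -- Right after a perturbation the elapsed time is `0`, so the return test cannot fire when `tThres
  -- ≥ 1`.
  rintro ⟨h1, -⟩
  simp only [sub_self] at h1
  omega

theorem run_succ_of_not_isPerturbation {n : ℕ} (hout : (run p f lam x₀ ξ n).output = none)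
    (h : ¬ IsPerturbation p f lam x₀ ξ n) :
    run p f lam x₀ ξ (n + 1) = returnOrDescend p f lam n (run p f lam x₀ ξ n) := by
  rw [run_succ_of_none hout, perturb, if_neg fun h' => h ⟨hout, h'⟩]

end

theorem PhiStar_le {d : ℕ} {f : E d → ℝ} {lam : ℝ} (hb : BddBelow (Set.range (Phi f lam)))
    (x : E d) : PhiStar f lam ≤ Phi f lam x := ciInf_le hb x

namespace Setting

variable {p : Params} {f : E p.d → ℝ} {lam : ℝ} (hs : Setting p f lam)
include hs

theorem one_le_tThres : 1 ≤ p.tThres := by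
  have h3 := hs.c_pos
  have h4 := p.twelve_le_χ
  have h5 := hs.one_le_κ
  rw [p.tThres_eq, Nat.one_le_ceil_iff]
  positivity

theorem Phi_proxStep_le (x : E p.d) : Phi f lam (proxStep f lam p.η x) ≤ Phi f lam x := by
  have h1 := hs.lip.Phi_proxStep_le hs.η_pos hs.η_mul_L_le hs.lam_nonneg x
  have := hs.η_pos
  have : 0 ≤ ‖proxStep f lam p.η x - x‖ ^ 2 / (2 * p.η) := by positivity
  linarith

theorem Phi_proxStep_le_of_gThres_le {x : E p.d} (h : p.gThres ≤ ‖gradMap f lam p.η x‖) :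
    Phi f lam (proxStep f lam p.η x) ≤ Phi f lam x - p.η / 2 * p.gThres ^ 2 := by
  have h1 := hs.lip.Phi_proxStep_le hs.η_pos hs.η_mul_L_le hs.lam_nonneg x
  have hη := hs.η_pos
  have hg : 0 ≤ p.gThres := by
    rw [hs.gThres_eq]; exact (mul_pos hs.L_pos hs.r_pos).le
  rw [norm_proxStep_sub_eq hη] at h1
  have h2 : (p.η * ‖gradMap f lam p.η x‖) ^ 2 / (2 * p.η)
      = p.η / 2 * ‖gradMap f lam p.η x‖ ^ 2 := by field_simp
  have h3 : p.η / 2 * p.gThres ^ 2 ≤ p.η / 2 * ‖gradMap f lam p.η x‖ ^ 2 := by gcongr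
  linarith

/-- A deterministic invariant of every run: iterations are charged to large-gradient steps (`k`) and
completed cycles (`m`), each paid for by a decrease of the objective. Only the last, uncompleted or
failed, cycle may contain an unpaid saddle. -/
theorem runPhase (x₀ : E p.d) (ξ : ℕ → E p.d) (n : ℕ) : RunPhase p f lam x₀ ξ n := by
  classical
  have hT := hs.one_le_tThres
  induction n with
  | zero =>
    refine .free 0 0 rfl ?_ (by simp) (by simp [PhiBelow, run, initState]) (by simp [saddleCount])
    simp [run, initState]
  | succ n ih =>
    cases ih with
    | free k m hout hwait hn hPhi hcount =>
      by_cases hg : ‖gradMap f lam p.η (run p f lam x₀ ξ n).x‖ < p.gThres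
      · have hpert : IsPerturbation p f lam x₀ ξ n := ⟨hout, hg, hwait⟩
        have hrun := run_succ_of_isPerturbation hT hpert
        refine .waiting k m n 1 ?_ le_rfl hT rfl hn ?_ hpert ?_ ?_ hPhi ?_
        · rw [hrun]
        · rw [hrun]
        · rw [hrun]
        · rw [hrun]; rfl
        · rw [saddleCount_succ]
          simp only [IsSaddlePerturbation, hpert, true_and]
          omega
      · have hpert : ¬ IsPerturbation p f lam x₀ ξ n := fun h => hg h.2.1
        have hrun := run_succ_of_not_isPerturbation hout hpert
        rw [returnOrDescend, if_neg fun h => by omega] at hrun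
        refine .free (k + 1) m ?_ ?_ (by omega) ?_ ?_
        · rw [hrun]; exact hout
        · rw [hrun]; push_cast; omega
        · rw [hrun]
          unfold PhiBelow at hPhi ⊢
          have := hs.Phi_proxStep_le_of_gThres_le (not_lt.1 hg)
          push_cast
          linarith
        · rwa [saddleCount_succ_of_not hpert]
    | waiting k m τ j hout hj hjT hn hτ hnoise hpertτ hanchor hx hPhi hcount =>
      have hpert : ¬ IsPerturbation p f lam x₀ ξ n := fun h => by
        have := h.2.2
        omega
      have hrun := run_succ_of_not_isPerturbation hout hpert
      rw [returnOrDescend] at hrun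
      rw [← saddleCount_succ_of_not hpert] at hcount
      split_ifs at hrun with hret
      · have hjT' : j = p.tThres := by omega
        refine .done k m τ (by omega) hpertτ ?_ ?_ hPhi hcount
        · rw [hrun, ← hanchor]
        · have := hret.2
          rwa [hx, hanchor, hjT'] at this
      · have hx' : (run p f lam x₀ ξ (n + 1)).x
            = (proxStep f lam p.η)^[j + 1] ((run p f lam x₀ ξ τ).x + ξ τ) := by
          rw [hrun, Function.iterate_succ_apply', ← hx]
        rcases hjT.lt_or_eq with hjT' | hjT'
        · refine .waiting k m τ (j + 1) ?_ (by omega) (by omega) (by omega) hτ ?_ hpertτ ?_ hx'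
            hPhi hcount
          · rw [hrun]; exact hout
          · rw [hrun]; exact hnoise
          · rw [hrun]; exact hanchor
        -- The iteration that performs a failed return test also takes a proximal step, so a
        -- completed cycle lasts `tThres + 1` iterations.
        · refine .free k (m + 1) ?_ ?_ ?_ ?_ ?_
          · rw [hrun]; exact hout
          · rw [hrun]; push_cast; omega
          · rw [hn, hτ, hjT']; ring
          · have h1 : Phi f lam (run p f lam x₀ ξ n).x
                ≤ Phi f lam (run p f lam x₀ ξ n).anchor - p.PhiThres := by
              by_contra hcon
              exact hret ⟨by omega, by linarith⟩
            have h2 := hs.Phi_proxStep_le (run p f lam x₀ ξ n).x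
            rw [hrun]
            rw [hanchor] at h1
            unfold PhiBelow at hPhi ⊢
            push_cast
            linarith
          · refine hcount.trans ?_
            split_ifs <;> omega
    | done k m τ hτ hpertτ hout hstuck hPhi hcount =>
      have hpert : ¬ IsPerturbation p f lam x₀ ξ n := fun h => by
        have := h.1
        rw [hout] at this
        exact absurd this (by simp)
      have hrun := run_succ_of_some hout
      rw [← saddleCount_succ_of_not hpert] at hcount
      exact .done k m τ (by omega) hpertτ (by rw [hrun]; exact hout) hstuck hPhi hcount

/-- A point returned by the algorithm is an approximate second-order stationary point unless a
saddle point was perturbed without success. -/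
theorem isSecondOrderStationary_or {x₀ : E p.d} {ξ : ℕ → E p.d} {n : ℕ} {y : E p.d}
    (hy : (run p f lam x₀ ξ n).output = some y) :
    IsSecondOrderStationary f lam p.η p.ρ p.ε y ∨
      ∃ t < n, IsSaddlePerturbation p f lam x₀ ξ t ∧
        Stuck p f lam (run p f lam x₀ ξ t).x ((run p f lam x₀ ξ t).x + ξ t) := by
  cases hs.runPhase x₀ ξ n with
  | free k m hout => rw [hout] at hy; exact absurd hy (by simp)
  | waiting k m τ j hout => rw [hout] at hy; exact absurd hy (by simp)
  | done k m τ hτ hpert hout hstuck =>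
    rw [hout, Option.some_inj] at hy
    by_cases hsad : IsSaddle f p.γ y
    · exact .inr ⟨τ, hτ, ⟨hpert, hy ▸ hsad⟩, hstuck⟩
    · refine .inl ⟨hy ▸ hpert.2.1.le.trans hs.gThres_le, fun a ha => ?_⟩
      by_contra hlt
      refine hsad ?_
      obtain ⟨v, hv⟩ := ha.exists_hasEigenvector
      have hv0 : 0 < ‖v‖ := norm_pos_iff.2 hv.2
      have h1 : hessian f y v = a • v := hv.apply_eq_smul
      refine ⟨v, ?_⟩
      rw [h1, inner_smul_left, real_inner_self_eq_norm_sq]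
      exact mul_lt_mul_of_pos_right (not_le.1 hlt) (by positivity)

/-- Completed cycles are paid for by their decrease. A possible last saddle is paid for by its own
height above the infimum; a spare `+ 1` here would ruin the probability bound when the gap is tiny.
-/
theorem saddleCount_mul_le (hb : BddBelow (Set.range (Phi f lam))) (x₀ : E p.d) (ξ : ℕ → E p.d)
    (n : ℕ) : saddleCount p f lam x₀ ξ n * p.PhiThres ≤ Phi f lam x₀ - PhiStar f lam := by
  classical
  have hA : 0 ≤ p.η / 2 * p.gThres ^ 2 := by
    have := hs.η_pos
    positivity
  have hB := hs.PhiThres_pos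
  have key : ∀ (k m : ℕ) (x : E p.d), PhiBelow p f lam x₀ k m x →
      saddleCount p f lam x₀ ξ n ≤ m + (if IsSaddle f p.γ x then 1 else 0) →
      saddleCount p f lam x₀ ξ n * p.PhiThres ≤ Phi f lam x₀ - PhiStar f lam := by
    intro k m x hPhi hcount
    have h1 : (saddleCount p f lam x₀ ξ n : ℝ) ≤ m + (if IsSaddle f p.γ x then 1 else 0) := by
      exact_mod_cast hcount
    have h2 := mul_le_mul_of_nonneg_right h1 hB.le
    have h3 : (if IsSaddle f p.γ x then (1 : ℝ) else 0) * p.PhiThres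
        ≤ Phi f lam x - PhiStar f lam := by
      split_ifs with h
      · obtain ⟨y, hy⟩ := hs.exists_Phi_le_of_isSaddle h
        linarith [PhiStar_le hb y]
      · linarith [PhiStar_le hb x]
    have h4 : 0 ≤ k * (p.η / 2 * p.gThres ^ 2) := by positivity
    unfold PhiBelow at hPhi
    linarith
  cases hs.runPhase x₀ ξ n with
  | free k m _ _ _ hPhi hcount => exact key k m _ hPhi (hcount.trans (by omega))
  | waiting k m τ j _ _ _ _ _ _ _ _ _ hPhi hcount => exact key k m _ hPhi hcount
  | done k m τ _ _ _ _ hPhi hcount => exact key k m _ hPhi hcount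

theorem le_of_output_eq_none (hb : BddBelow (Set.range (Phi f lam))) {x₀ : E p.d}
    {ξ : ℕ → E p.d} {n : ℕ} (hn : (run p f lam x₀ ξ n).output = none) :
    (n : ℝ) ≤ (Phi f lam x₀ - PhiStar f lam) / (p.η / 2 * p.gThres ^ 2)
      + ((Phi f lam x₀ - PhiStar f lam) / p.PhiThres + 1) * (p.tThres + 1) := by
  have hA : 0 < p.η / 2 * p.gThres ^ 2 := by
    have := hs.η_pos
    have := mul_pos hs.L_pos hs.r_pos
    rw [hs.gThres_eq]
    positivity
  have hB := hs.PhiThres_pos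
  -- The extra `+ 1` on `m` covers a cycle still in progress.
  have key : ∀ (k m : ℕ) (x : E p.d), PhiBelow p f lam x₀ k m x →
      n ≤ k + (m + 1) * (p.tThres + 1) →
      (n : ℝ) ≤ (Phi f lam x₀ - PhiStar f lam) / (p.η / 2 * p.gThres ^ 2)
      + ((Phi f lam x₀ - PhiStar f lam) / p.PhiThres + 1) * (p.tThres + 1) := by
    intro k m x hPhi hnk
    have h1 : (n : ℝ) ≤ k + (m + 1) * (p.tThres + 1) := by exact_mod_cast hnk
    have h2 := PhiStar_le hb x
    unfold PhiBelow at hPhi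
    have hkA : 0 ≤ k * (p.η / 2 * p.gThres ^ 2) := by positivity
    have hmB : 0 ≤ m * p.PhiThres := by positivity
    have h3 : (k : ℝ) ≤ (Phi f lam x₀ - PhiStar f lam) / (p.η / 2 * p.gThres ^ 2) := by
      rw [le_div_iff₀ hA]; linarith
    have h4 : (m : ℝ) ≤ (Phi f lam x₀ - PhiStar f lam) / p.PhiThres := by
      rw [le_div_iff₀ hB]; linarith
    refine h1.trans (add_le_add h3 (mul_le_mul_of_nonneg_right (by linarith) (by positivity)))
  cases hs.runPhase x₀ ξ n with
  | free k m _ _ hn hPhi => exact key k m _ hPhi (by rw [add_mul]; omega)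
  | waiting k m τ j _ _ _ _ _ _ _ _ _ hPhi => exact key k m _ hPhi (by rw [add_mul]; omega)
  | done k m τ _ _ hout => rw [hout] at hn; exact absurd hn (by simp)

end Setting

/-! ### Measurability and independence -/

/-- A conditional bound on the probability of an event in terms of two independent random variables
integrates to an unconditional one. -/
theorem measure_and_le_of_indepFun {Ω α β : Type*} [MeasurableSpace Ω] [MeasurableSpace α]
    [MeasurableSpace β] {P : Measure Ω} [IsProbabilityMeasure P] {Y : Ω → α} {Z : Ω → β}
    (hY : Measurable Y) (hZ : Measurable Z) (h : IndepFun Y Z P) {B : Set α}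
    (hB : MeasurableSet B) {S : Set (α × β)} (hS : MeasurableSet S) {c : ENNReal}
    (hc : ∀ y ∈ B, P.map Z {z | (y, z) ∈ S} ≤ c) :
    P {ω | Y ω ∈ B ∧ (Y ω, Z ω) ∈ S} ≤ c * P (Y ⁻¹' B) := by
  have := Measure.isProbabilityMeasure_map (μ := P) hZ.aemeasurable
  have hB' : MeasurableSet ((Prod.fst ⁻¹' B) ∩ S) := (measurable_fst hB).inter hS
  have h1 : P {ω | Y ω ∈ B ∧ (Y ω, Z ω) ∈ S}
      = P.map (fun ω => (Y ω, Z ω)) ((Prod.fst ⁻¹' B) ∩ S) := by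
    rw [Measure.map_apply (hY.prodMk hZ) hB']; rfl
  rw [h1, (indepFun_iff_map_prod_eq_prod_map_map hY.aemeasurable hZ.aemeasurable).1 h]
  have := Measure.isProbabilityMeasure_map (μ := P) hY.aemeasurable
  rw [Measure.prod_apply hB']
  calc _ ≤ ∫⁻ y, B.indicator (fun _ => c) y ∂(P.map Y) := by
        refine lintegral_mono fun y => ?_
        by_cases hy : y ∈ B
        · rw [Set.indicator_of_mem hy]
          exact (measure_mono fun z hz => hz.2).trans (hc y hy)
        · rw [Set.indicator_of_notMem hy]
          have : Prod.mk y ⁻¹' ((Prod.fst ⁻¹' B) ∩ S) = ∅ :=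
            Set.eq_empty_of_forall_notMem fun z hz => hy hz.1
          rw [this, measure_empty]
    _ = c * P (Y ⁻¹' B) := by
        rw [lintegral_indicator_const hB, Measure.map_apply hY hB]

theorem isOpen_isSaddle {d : ℕ} {f : E d → ℝ} {L ρ : ℝ} (hf : LipschitzAssumption f L ρ) (γ : ℝ) :
    IsOpen {x | IsSaddle f γ x} := by
  have h : {x | IsSaddle f γ x} = ⋃ v, {x | inner ℝ (hessian f x v) v < -γ * ‖v‖ ^ 2} := by
    ext x; simp [IsSaddle]
  rw [h]
  refine isOpen_iUnion fun v => isOpen_lt ?_ continuous_const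
  have := hf.continuous_hessian
  fun_prop

namespace Setting

variable {p : Params} {f : E p.d → ℝ} {lam : ℝ} (hs : Setting p f lam)
include hs

theorem continuous_gradMap : Continuous (gradMap f lam p.η) :=
  (continuous_id.sub (hs.lip.continuous_proxStep hs.η_pos.le hs.lam_nonneg)).const_smul p.η⁻¹

open Classical in
/-- The components of the state after `n` iterations are measurable in the first `n` perturbation
vectors. -/
theorem measurable_run {Ω : Type*} [MeasurableSpace Ω] (x₀ : E p.d) {ξ : ℕ → Ω → E p.d} (n : ℕ)
    (hξ : ∀ i < n, Measurable (ξ i)) :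
    (Measurable fun ω => (run p f lam x₀ (fun t => ξ t ω) n).x) ∧
    (Measurable fun ω => (run p f lam x₀ (fun t => ξ t ω) n).anchor) ∧
    (Measurable fun ω => (run p f lam x₀ (fun t => ξ t ω) n).tNoise) ∧
    MeasurableSet {ω | (run p f lam x₀ (fun t => ξ t ω) n).output = none} := by
  induction n with
  | zero => simp [run, initState]
  | succ n ih =>
    obtain ⟨hx, ha, ht, ho⟩ := ih fun i hi => hξ i (by omega)
    have hξn := hξ n (by omega)
    have hΦ := (hs.lip.continuous_Phi lam).measurable
    have hG := hs.continuous_gradMap.norm.measurable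
    have hstep := (hs.lip.continuous_proxStep hs.η_pos.le hs.lam_nonneg).measurable
    set s := fun ω => run p f lam x₀ (fun t => ξ t ω) n with hsdef
    set C : Set Ω := {ω | ‖gradMap f lam p.η (s ω).x‖ < p.gThres ∧
      (p.tThres : ℤ) < (n : ℤ) - (s ω).tNoise} with hC
    have hCm : MeasurableSet C := by
      have hw : MeasurableSet {ω | (p.tThres : ℤ) < (n : ℤ) - (s ω).tNoise} :=
        measurableSet_lt measurable_const
          ((measurable_of_countable fun z : ℤ => (n : ℤ) - z).comp ht)
      exact (measurableSet_lt (hG.comp hx) measurable_const).inter hw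
    set s' := fun ω => perturb p f lam n (ξ n ω) (s ω) with hs'
    have hx' : Measurable fun ω => (s' ω).x := by
      have e : (fun ω => (s' ω).x)
          = fun ω => if ω ∈ C then (s ω).x + ξ n ω else (s ω).x := by
        funext ω
        simp only [hs', perturb, hC, Set.mem_ofPred_eq]
        split_ifs <;> rfl
      rw [e]
      exact Measurable.ite hCm (hx.add hξn) hx
    have ha' : Measurable fun ω => (s' ω).anchor := by
      have e : (fun ω => (s' ω).anchor)
          = fun ω => if ω ∈ C then (s ω).x else (s ω).anchor := by
        funext ω
        simp only [hs', perturb, hC, Set.mem_ofPred_eq]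
        split_ifs <;> rfl
      rw [e]
      exact Measurable.ite hCm hx ha
    have ht' : Measurable fun ω => (s' ω).tNoise := by
      have e : (fun ω => (s' ω).tNoise)
          = fun ω => if ω ∈ C then (n : ℤ) else (s ω).tNoise := by
        funext ω
        simp only [hs', perturb, hC, Set.mem_ofPred_eq]
        split_ifs <;> rfl
      rw [e]
      exact Measurable.ite hCm measurable_const ht
    have ho' : ∀ ω, (s' ω).output = (s ω).output := by
      intro ω
      simp only [hs', perturb]
      split_ifs <;> rfl
    set D : Set Ω := {ω | (n : ℤ) - (s' ω).tNoise = (p.tThres : ℤ) ∧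
      -p.PhiThres < Phi f lam (s' ω).x - Phi f lam (s' ω).anchor} with hD
    have hDm : MeasurableSet D := by
      refine MeasurableSet.inter ?_
        (measurableSet_lt measurable_const ((hΦ.comp hx').sub (hΦ.comp ha')))
      exact ((measurable_of_countable fun z : ℤ => (n : ℤ) - z).comp ht')
        (measurableSet_singleton (p.tThres : ℤ))
    have hrun : ∀ ω, run p f lam x₀ (fun t => ξ t ω) (n + 1)
        = if (s ω).output = none then
            (if ω ∈ D then { s' ω with output := some (s' ω).anchor }
              else { s' ω with x := proxStep f lam p.η (s' ω).x })
          else s ω := by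
      intro ω
      rcases h : (s ω).output with _ | y
      · rw [if_pos rfl, run_succ_of_none h]
        rfl
      · rw [if_neg (by simp), run_succ_of_some h]
    refine ⟨?_, ?_, ?_, ?_⟩
    · have e : (fun ω => (run p f lam x₀ (fun t => ξ t ω) (n + 1)).x)
          = fun ω => if (s ω).output = none then
            (if ω ∈ D then (s' ω).x else proxStep f lam p.η (s' ω).x) else (s ω).x := by
        funext ω
        rw [hrun]
        split_ifs <;> rfl
      rw [e]
      exact Measurable.ite ho (Measurable.ite hDm hx' (hstep.comp hx')) hx
    · have e : (fun ω => (run p f lam x₀ (fun t => ξ t ω) (n + 1)).anchor)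
          = fun ω => if (s ω).output = none then (s' ω).anchor else (s ω).anchor := by
        funext ω
        rw [hrun]
        split_ifs <;> rfl
      rw [e]
      exact Measurable.ite ho ha' ha
    · have e : (fun ω => (run p f lam x₀ (fun t => ξ t ω) (n + 1)).tNoise)
          = fun ω => if (s ω).output = none then (s' ω).tNoise else (s ω).tNoise := by
        funext ω
        rw [hrun]
        split_ifs <;> rfl
      rw [e]
      exact Measurable.ite ho ht' ht
    · have e : {ω | (run p f lam x₀ (fun t => ξ t ω) (n + 1)).output = none}
          = {ω | (s ω).output = none} ∩ Dᶜ := by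
        ext ω
        rw [Set.mem_ofPred_eq, hrun]
        by_cases h : (s ω).output = none
        · by_cases h' : ω ∈ D
          · simp [h, h']
          · simp [h, h', ho']
        · simp [h]
      rw [e]
      exact ho.inter hDm.compl

theorem measurableSet_isSaddlePerturbation {Ω : Type*} [MeasurableSpace Ω] (x₀ : E p.d)
    {ξ : ℕ → Ω → E p.d} (n : ℕ) (hξ : ∀ i < n, Measurable (ξ i)) :
    MeasurableSet {ω | IsSaddlePerturbation p f lam x₀ (fun t => ξ t ω) n} := by
  obtain ⟨hx, ha, ht, ho⟩ := hs.measurable_run x₀ n hξ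
  have hG := hs.continuous_gradMap.norm.measurable
  have hw : MeasurableSet {ω | (p.tThres : ℤ)
      < (n : ℤ) - (run p f lam x₀ (fun t => ξ t ω) n).tNoise} :=
    measurableSet_lt measurable_const
      ((measurable_of_countable fun z : ℤ => (n : ℤ) - z).comp ht)
  exact (ho.inter ((measurableSet_lt (hG.comp hx) measurable_const).inter hw)).inter
    (hx (isOpen_isSaddle hs.lip p.γ).measurableSet)

variable {Ω : Type*} [MeasurableSpace Ω] {P : Measure Ω} [IsProbabilityMeasure P]
  {ξ : ℕ → Ω → E p.d} (hξ : ∀ t, Measurable (ξ t)) (hind : iIndepFun ξ P)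
  (hunif : ∀ t, pdf.IsUniform (ξ t) (Metric.closedBall 0 p.r) P volume)
include hξ

theorem measurableSet_stuck (x₀ : E p.d) (t : ℕ) :
    MeasurableSet {ω | IsSaddlePerturbation p f lam x₀ (fun t => ξ t ω) t ∧
      Stuck p f lam (run p f lam x₀ (fun t => ξ t ω) t).x
        ((run p f lam x₀ (fun t => ξ t ω) t).x + ξ t ω)} :=
  (hs.measurableSet_isSaddlePerturbation x₀ t fun i _ => hξ i).inter
    (((hs.measurable_run x₀ t fun i _ => hξ i).1.prodMk (hξ t)) hs.isOpen_stuck.measurableSet)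

include hind hunif

theorem measure_stuck_le (x₀ : E p.d) (t : ℕ) :
    P {ω | IsSaddlePerturbation p f lam x₀ (fun t => ξ t ω) t ∧
      Stuck p f lam (run p f lam x₀ (fun t => ξ t ω) t).x
        ((run p f lam x₀ (fun t => ξ t ω) t).x + ξ t ω)}
      ≤ ENNReal.ofReal p.δ₁ * P {ω | IsSaddlePerturbation p f lam x₀ (fun t => ξ t ω) t} := by
  set X : Ω → E p.d := fun ω => (run p f lam x₀ (fun t => ξ t ω) t).x with hX
  set Q : Ω → Prop := fun ω => IsSaddlePerturbation p f lam x₀ (fun t => ξ t ω) t with hQ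
  -- The past enters through the iterate and the truth value of the event; the latter is needed
  -- because it also depends on the output and the time of the last perturbation.
  set Y : Ω → E p.d × Prop := fun ω => (X ω, Q ω) with hY
  -- Stated for an arbitrary σ-algebra, so that it applies to the one generated by the `ξ i` with `i
  -- < t`, which is independent of `ξ t`.
  have hYm : ∀ m : MeasurableSpace Ω, (∀ i < t, Measurable[m] (ξ i)) → Measurable[m] Y := by
    intro m hm
    exact (hs.measurable_run x₀ t hm).1.prodMk
      (measurableSet_setOfPred.1 (hs.measurableSet_isSaddlePerturbation x₀ t hm))
  have hindep : IndepFun Y (ξ t) P := by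
    have h1 := indep_iSup_of_disjoint (fun i => (hξ i).comap_le) hind
      (S := Set.Iio t) (T := {t}) (by simp)
    refine indep_of_indep_of_le_left (indep_of_indep_of_le_right h1 ?_) ?_
    · exact le_iSup₂_of_le t rfl le_rfl
    · refine (hYm _ fun i hi => ?_).comap_le
      exact measurable_iff_comap_le.2 (le_iSup₂_of_le i hi le_rfl)
  set B : Set (E p.d × Prop) :=
    {y | ‖gradMap f lam p.η y.1‖ < p.gThres ∧ IsSaddle f p.γ y.1 ∧ y.2} with hB
  have hBm : MeasurableSet B := by
    refine (measurableSet_lt (hs.continuous_gradMap.norm.measurable.comp measurable_fst)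
      measurable_const).inter (MeasurableSet.inter ?_ ?_)
    · exact measurable_fst (isOpen_isSaddle hs.lip p.γ).measurableSet
    · exact measurableSet_setOfPred.2 measurable_snd
  set S : Set ((E p.d × Prop) × E p.d) := {q | Stuck p f lam q.1.1 (q.1.1 + q.2)} with hS
  have hSm : MeasurableSet S :=
    ((measurable_fst.comp measurable_fst).prodMk measurable_snd) hs.isOpen_stuck.measurableSet
  have hball0 : volume (Metric.closedBall (0 : E p.d) p.r) ≠ 0 :=
    (Metric.measure_closedBall_pos volume _ hs.r_pos).ne'
  have hballT : volume (Metric.closedBall (0 : E p.d) p.r) ≠ ⊤ :=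
    measure_closedBall_lt_top.ne
  have hYB : ∀ ω, Y ω ∈ B ↔ Q ω := fun ω => ⟨fun h => h.2.2, fun h => ⟨h.1.2.1, h.2, h⟩⟩
  have key := measure_and_le_of_indepFun (hYm _ fun i _ => hξ i) (hξ t) hindep hBm hSm
    (c := ENNReal.ofReal p.δ₁) fun y hy => ?_
  · refine le_trans (le_of_eq ?_) (key.trans (le_of_eq ?_))
    · congr 1
      ext ω
      exact and_congr_left fun _ => (hYB ω).symm
    · congr 2
      ext ω
      exact hYB ω
  · have hu := hunif t
    rw [pdf.IsUniform] at hu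
    have hslice : {z | (y, z) ∈ S} = {z | Stuck p f lam y.1 (y.1 + z)} := rfl
    rw [hu, cond_apply measurableSet_closedBall, ENNReal.inv_mul_le_iff hball0 hballT, hslice,
      mul_comm (volume _)]
    exact hs.volume_stuck_le hy.1 hy.2.1

/-- The expected number of failures at saddle points bounds the probability of returning one. -/
theorem measure_exists_stuck_le (hb : BddBelow (Set.range (Phi f lam))) (x₀ : E p.d) (n : ℕ) :
    P (⋃ t ∈ Finset.range n, {ω | IsSaddlePerturbation p f lam x₀ (fun t => ξ t ω) t ∧
      Stuck p f lam (run p f lam x₀ (fun t => ξ t ω) t).x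
        ((run p f lam x₀ (fun t => ξ t ω) t).x + ξ t ω)})
      ≤ ENNReal.ofReal (p.δ₁ * ((Phi f lam x₀ - PhiStar f lam) / p.PhiThres)) := by
  classical
  have hδ : 0 ≤ p.δ₁ := by
    have := hs.one_le_κ
    rw [Params.δ₁]; positivity
  set Q : ℕ → Set Ω := fun t => {ω | IsSaddlePerturbation p f lam x₀ (fun t => ξ t ω) t} with hQ
  have hQm : ∀ t, MeasurableSet (Q t) := fun t =>
    hs.measurableSet_isSaddlePerturbation x₀ t fun i _ => hξ i
  have hcount : ∀ ω, ∑ t ∈ Finset.range n, (Q t).indicator (fun _ => (1 : ENNReal)) ω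
      = (saddleCount p f lam x₀ (fun t => ξ t ω) n : ENNReal) := by
    intro ω
    rw [saddleCount, Nat.count_eq_card_filter_range, Finset.card_filter]
    push_cast
    refine Finset.sum_congr rfl fun t _ => ?_
    simp [Set.indicator_apply, hQ]
  -- The sum of the probabilities is the expected number of perturbed saddles, bounded independently
  -- of `n`; bounding each probability by `1` would cost a factor `n`.
  have hsum : ∑ t ∈ Finset.range n, P (Q t)
      ≤ ENNReal.ofReal ((Phi f lam x₀ - PhiStar f lam) / p.PhiThres) := by
    calc ∑ t ∈ Finset.range n, P (Q t)
        = ∑ t ∈ Finset.range n, ∫⁻ ω, (Q t).indicator (fun _ => (1 : ENNReal)) ω ∂P := by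
          refine Finset.sum_congr rfl fun t _ => ?_
          rw [lintegral_indicator_const (hQm t), one_mul]
      _ = ∫⁻ ω, ∑ t ∈ Finset.range n, (Q t).indicator (fun _ => (1 : ENNReal)) ω ∂P :=
          (lintegral_finsetSum _ fun t _ => measurable_const.indicator (hQm t)).symm
      _ ≤ ∫⁻ _, ENNReal.ofReal ((Phi f lam x₀ - PhiStar f lam) / p.PhiThres) ∂P := by
          refine lintegral_mono fun ω => ?_
          rw [hcount, ← ENNReal.ofReal_natCast]
          refine ENNReal.ofReal_le_ofReal ?_
          rw [le_div_iff₀ hs.PhiThres_pos]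
          exact hs.saddleCount_mul_le hb x₀ _ n
      _ = _ := by simp
  calc _ ≤ ∑ t ∈ Finset.range n, P {ω | IsSaddlePerturbation p f lam x₀ (fun t => ξ t ω) t ∧
          Stuck p f lam (run p f lam x₀ (fun t => ξ t ω) t).x
            ((run p f lam x₀ (fun t => ξ t ω) t).x + ξ t ω)} := measure_biUnion_finset_le _ _
    _ ≤ ∑ t ∈ Finset.range n, ENNReal.ofReal p.δ₁ * P (Q t) :=
        Finset.sum_le_sum fun t _ => hs.measure_stuck_le hξ hind hunif x₀ t
    _ = ENNReal.ofReal p.δ₁ * ∑ t ∈ Finset.range n, P (Q t) := (Finset.mul_sum _ _ _).symm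
    _ ≤ _ := by
        rw [ENNReal.ofReal_mul hδ]
        gcongr

end Setting

/-! ### The constants -/

/-- Take the cube root and compare with the tangent of the exponential at `χ = 12`, using `12 ≤ exp
(8 / 3)`. -/
theorem cube_le_exp {χ : ℝ} (hχ : 12 ≤ χ) : χ ^ 3 ≤ Real.exp (2 * χ / 3) := by
  have h1 : χ ≤ Real.exp (2 * χ / 9) := by
    have h2 : Real.exp (2 * χ / 9) = Real.exp (8 / 3) * Real.exp (2 * (χ - 12) / 9) := by
      rw [← Real.exp_add]; ring_nf
    have h3 := Real.add_one_le_exp (2 * (χ - 12) / 9)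
    have h4 : (12 : ℝ) ≤ Real.exp (8 / 3) := by
      have := Real.exp_one_gt_d9
      have h5 : Real.exp (8 / 3) ^ 3 = Real.exp 1 ^ 8 := by
        rw [← Real.exp_nat_mul, ← Real.exp_nat_mul]; norm_num
      have h6 : (27 / 10 : ℝ) ^ 8 ≤ Real.exp 1 ^ 8 :=
        pow_le_pow_left₀ (by norm_num) (by linarith) 8
      refine le_of_pow_le_pow_left₀ (n := 3) (by norm_num) (Real.exp_pos _).le ?_
      rw [h5]
      refine le_trans ?_ h6
      norm_num
    rw [h2]
    have : 12 * (2 * (χ - 12) / 9 + 1) ≤ Real.exp (8 / 3) * Real.exp (2 * (χ - 12) / 9) :=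
      mul_le_mul h4 h3 (by linarith) (by positivity)
    linarith
  calc χ ^ 3 ≤ Real.exp (2 * χ / 9) ^ 3 := pow_le_pow_left₀ (by linarith) h1 3
    _ = Real.exp (2 * χ / 3) := by rw [← Real.exp_nat_mul]; congr 1; push_cast; ring

namespace Params.Admissible

variable {p : Params} (hp : p.Admissible)
include hp

/-- This explains the factor `3` in `χ`: of `exp (-χ)`, one third absorbs the argument of the
logarithm and two thirds absorb the `χ³` coming from `PhiThres`. -/
theorem δ₁_mul_le (hδ : 0 < p.δ) {gap : ℝ} (h0 : 0 ≤ gap) (hgap : gap ≤ p.ΔΦ) :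
    p.δ₁ * (gap / p.PhiThres) ≤ p.δ := by
  have h1 := hp.γ_pos
  have h2 := hp.ρ_pos
  have h3 := hp.c_pos
  have h4 := p.twelve_le_χ
  have h5 := hp.one_le_κ
  have h6 := hp.ε_pos
  have h7 := hp.L_pos
  have h8 : (0 : ℝ) < p.d := by exact_mod_cast hp.d_pos
  rcases h0.eq_or_lt with h | hpos
  · rw [← h]; simpa using hδ.le
  have hΔ : 0 < p.ΔΦ := hpos.trans_le hgap
  set X := p.d * p.L * p.ΔΦ / (p.c * p.ε ^ 2 * p.δ) with hX
  have hX0 : 0 < X := by positivity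
  have hXχ : X ≤ Real.exp (p.χ / 3) := by
    rw [← Real.log_le_iff_le_exp hX0, Params.χ]
    have := le_max_left (Real.log X) 4
    linarith
  have e1 : p.δ₁ * (gap / p.PhiThres)
      = p.δ * (p.d * p.L * gap / (p.c * p.ε ^ 2 * p.δ)) * (p.χ ^ 3 * Real.exp (-p.χ)) := by
    rw [Params.δ₁, hp.PhiThres_eq, hp.ε_eq, hp.L_eq]
    field_simp
  have e2 : p.d * p.L * gap / (p.c * p.ε ^ 2 * p.δ) ≤ X := by
    rw [hX]; gcongr
  have e3 : p.χ ^ 3 * Real.exp (-p.χ) ≤ Real.exp (-(p.χ / 3)) := by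
    have := mul_le_mul_of_nonneg_right (cube_le_exp h4) (Real.exp_pos (-p.χ)).le
    rw [← Real.exp_add] at this
    refine this.trans_eq ?_
    ring_nf
  calc _ ≤ p.δ * Real.exp (p.χ / 3) * Real.exp (-(p.χ / 3)) := by
        rw [e1]
        have := e2.trans hXχ
        gcongr
    _ = p.δ := by rw [mul_assoc, ← Real.exp_add]; simp

theorem χ_le (hδ : 0 < p.δ) (hΔ : 0 ≤ p.ΔΦ) : p.χ ≤ 3 * (4 - Real.log p.c) * logTerm p := by
  have h3 := hp.c_pos
  have h6 := hp.ε_pos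
  have h7 := hp.L_pos
  have h8 : (0 : ℝ) < p.d := by exact_mod_cast hp.d_pos
  have hc : Real.log p.c ≤ 0 := Real.log_nonpos h3.le (by linarith [hp.c_le])
  have hl : 1 ≤ logTerm p := le_max_left _ _
  rw [Params.χ, mul_assoc 3]
  refine mul_le_mul_of_nonneg_left (max_le ?_ ?_) (by norm_num)
  swap
  · nlinarith
  rcases hΔ.eq_or_lt with h | hpos
  -- For `ΔΦ = 0` the convention `Real.log 0 = 0` produces `χ = 12`, as prescribed.
  · rw [← h]; simp only [mul_zero, zero_div, Real.log_zero]; nlinarith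
  have e1 : p.d * p.L * p.ΔΦ / (p.c * p.ε ^ 2 * p.δ)
      = p.d * p.L * p.ΔΦ / (p.ε ^ 2 * p.δ) / p.c := by field_simp
  rw [e1, Real.log_div (by positivity) h3.ne']
  have e2 : Real.log (p.d * p.L * p.ΔΦ / (p.ε ^ 2 * p.δ)) ≤ logTerm p := le_max_right _ _
  nlinarith

theorem iterations_le (hδ : 0 < p.δ) (hΔ : 0 ≤ p.ΔΦ) {gap : ℝ} (h0 : 0 ≤ gap) :
    gap / (p.η / 2 * p.gThres ^ 2) + (gap / p.PhiThres + 1) * (p.tThres + 1) + 1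
      ≤ 5 * (3 * (4 - Real.log p.c)) ^ 4 / p.c ^ 3 * iterBound p gap := by
  have h1 := hp.γ_pos
  have h2 := hp.ρ_pos
  have h3 := hp.c_pos
  have h4 := p.twelve_le_χ
  have h5 := hp.one_le_κ
  have h7 := hp.L_pos
  have h8 := hp.ε_pos
  have hc1 : p.c ≤ 1 := by linarith [hp.c_le]
  have hl : 1 ≤ logTerm p := le_max_left _ _
  have hχ := hp.χ_le hδ hΔ
  have hlogc : Real.log p.c ≤ 0 := Real.log_nonpos h3.le hc1
  set M := 3 * (4 - Real.log p.c) with hM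
  have hM1 : 1 ≤ M := by linarith
  have hB := hp.PhiThres_pos
  set D := p.L * gap / p.ε ^ 2 with hD
  have hD0 : 0 ≤ D := by positivity
  have hT : (p.tThres : ℝ) + 1 ≤ 3 * (p.χ * p.κ / p.c ^ 2) := by
    have e1 : 0 ≤ p.χ * p.κ / p.c ^ 2 := by positivity
    have e2 := (Nat.ceil_lt_add_one e1).le
    rw [← p.tThres_eq] at e2
    have e3 : 1 ≤ p.χ * p.κ / p.c ^ 2 := by
      rw [le_div_iff₀ (by positivity)]
      nlinarith
    linarith
  have t1 : gap / (p.η / 2 * p.gThres ^ 2) = 2 / p.c ^ 2 * (p.χ ^ 4 * D) := by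
    rw [Params.gThres, Params.η, mul_pow, div_pow, hp.sqrt_c_sq, hD]
    field_simp
  have t2 : gap / p.PhiThres * (3 * (p.χ * p.κ / p.c ^ 2)) = 3 / p.c ^ 3 * (p.χ ^ 4 * D) := by
    rw [hp.PhiThres_eq, hD, hp.ε_eq, hp.L_eq]
    field_simp
  have t3 : gap / p.PhiThres * (p.tThres + 1) ≤ 3 / p.c ^ 3 * (p.χ ^ 4 * D) := by
    rw [← t2]
    exact mul_le_mul_of_nonneg_left hT (by positivity)
  have t4 : 2 / p.c ^ 2 ≤ 2 / p.c ^ 3 :=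
    div_le_div_of_nonneg_left (by norm_num) (by positivity)
      (pow_le_pow_of_le_one h3.le hc1 (by norm_num))
  have t5 : p.χ ^ 4 * D ≤ M ^ 4 * (D * logTerm p ^ 4) := by
    have : p.χ ^ 4 ≤ (M * logTerm p) ^ 4 := pow_le_pow_left₀ (by linarith) hχ 4
    rw [mul_pow] at this
    have := mul_le_mul_of_nonneg_right this hD0
    linarith
  have t6 : 3 * (p.χ * p.κ / p.c ^ 2) + 1 ≤ 5 / p.c ^ 3 * (M ^ 4 * (p.κ * logTerm p)) := by
    have e3 : 1 ≤ p.χ * p.κ / p.c ^ 2 := by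
      rw [le_div_iff₀ (by positivity)]
      nlinarith
    have e4 : p.χ * p.κ ≤ M ^ 4 * (p.κ * logTerm p) := by
      have e5 : M ≤ M ^ 4 := le_self_pow₀ hM1 (by norm_num)
      calc p.χ * p.κ ≤ (M * logTerm p) * p.κ := by gcongr
        _ ≤ (M ^ 4 * logTerm p) * p.κ := by gcongr
        _ = _ := by ring
    calc 3 * (p.χ * p.κ / p.c ^ 2) + 1 ≤ 5 * (p.χ * p.κ / p.c ^ 2) := by linarith
      _ = 5 / p.c ^ 2 * (p.χ * p.κ) := by ring
      _ ≤ 5 / p.c ^ 3 * (M ^ 4 * (p.κ * logTerm p)) := by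
        refine mul_le_mul ?_ e4 (by positivity) (by positivity)
        exact div_le_div_of_nonneg_left (by norm_num) (by positivity)
          (pow_le_pow_of_le_one h3.le hc1 (by norm_num))
  have hit : iterBound p gap = D * logTerm p ^ 4 + p.κ * logTerm p := rfl
  have hDχ : 0 ≤ p.χ ^ 4 * D := by positivity
  calc _ ≤ (2 / p.c ^ 3 + 3 / p.c ^ 3) * (p.χ ^ 4 * D) + (3 * (p.χ * p.κ / p.c ^ 2) + 1) := by
        have := mul_le_mul_of_nonneg_right t4 hDχ
        rw [t1, add_mul (gap / p.PhiThres)]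
        linarith
    _ = 5 / p.c ^ 3 * (p.χ ^ 4 * D) + (3 * (p.χ * p.κ / p.c ^ 2) + 1) := by ring
    _ ≤ 5 / p.c ^ 3 * (M ^ 4 * (D * logTerm p ^ 4))
        + 5 / p.c ^ 3 * (M ^ 4 * (p.κ * logTerm p)) := by
        gcongr
    _ = _ := by rw [hit]; ring

end Params.Admissible

end PPD

end

/-! ### Assembly of the main theorem. -/

theorem theorem1 :
    ∃ cmax : ℝ, 0 < cmax ∧ ∀ c : ℝ, 0 < c → c ≤ cmax → ∃ K : ℝ,
      ∀ (p : PPD.Params) (f : PPD.E p.d → ℝ) (lam : ℝ) (x₀ : PPD.E p.d),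
        p.c = c → 1 ≤ p.d → 0 < p.L → 0 < p.ρ → 0 < p.ε → p.ε ≤ p.L ^ 2 / p.ρ → 0 < p.δ →
        PPD.LipschitzAssumption f p.L p.ρ →
        0 ≤ lam →
        (∃ chat μ θ : ℝ, 3 ≤ chat ∧ μ ∈ Set.Ioc (0 : ℝ) 1 ∧ θ ∈ Set.Ioo (0 : ℝ) 1 ∧
          lam < p.lamBound chat μ θ) →
        BddBelow (Set.range (PPD.Phi f lam)) →
        PPD.Phi f lam x₀ - PPD.PhiStar f lam ≤ p.ΔΦ →
        ∀ (Ω : Type*) [MeasurableSpace Ω] (P : MeasureTheory.Measure Ω)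
          [MeasureTheory.IsProbabilityMeasure P] (ξ : ℕ → Ω → PPD.E p.d),
          (∀ t, Measurable (ξ t)) →
          ProbabilityTheory.iIndepFun ξ P →
          (∀ t, MeasureTheory.pdf.IsUniform (ξ t) (Metric.closedBall 0 p.r) P
            MeasureTheory.volume) →
          ENNReal.ofReal (1 - p.δ) ≤
            P {ω | ∃ n : ℕ,
              (n : ℝ) ≤ K * PPD.iterBound p (PPD.Phi f lam x₀ - PPD.PhiStar f lam) ∧
              ∃ y, (PPD.run p f lam x₀ (fun t => ξ t ω) n).output = some y ∧
                PPD.IsSecondOrderStationary f lam p.η p.ρ p.ε y} := by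
  -- The bound on `c` yields `15 √c ≤ 3 / 20` in `hessian_error_le`; `K` is the constant of
  -- `iterations_le`.
  refine ⟨1 / 10000, by norm_num, fun c hc0 hc => ⟨5 * (3 * (4 - Real.log c)) ^ 4 / c ^ 3, ?_⟩⟩
  rintro p f lam x₀ rfl hd hL hρ hε hεL hδ hf hlam ⟨chat, μ, θ, hchat, hμ, hθ, hlt⟩ hb hΔ Ω _ P _ ξ
    hξ hind hunif
  have hp : p.Admissible := ⟨hd, hL, hρ, hε, hεL, hc0, hc⟩
  have hs : PPD.Setting p f lam := ⟨hp, hf, hlam, hp.mul_sqrt_le hchat hμ hθ hlt⟩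
  have hgap : 0 ≤ PPD.Phi f lam x₀ - PPD.PhiStar f lam := sub_nonneg.2 (PPD.PhiStar_le hb x₀)
  set gap := PPD.Phi f lam x₀ - PPD.PhiStar f lam with hgapdef
  set N : ℝ := gap / (p.η / 2 * p.gThres ^ 2) + (gap / p.PhiThres + 1) * (p.tThres + 1) with hN
  have hN0 : 0 ≤ N := by
    have := hp.PhiThres_pos
    have := hp.η_pos
    positivity
  -- `n` strictly exceeds the deterministic bound, so every run has returned by then.
  set n := ⌊N⌋₊ + 1 with hn
  have hnN : N < n := by rw [hn]; push_cast; exact Nat.lt_floor_add_one N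
  have hnK : (n : ℝ) ≤ N + 1 := by
    rw [hn]; push_cast; linarith [Nat.floor_le hN0]
  have hbad := hs.measure_exists_stuck_le hξ hind hunif hb x₀ n
  set bad := ⋃ t ∈ Finset.range n, {ω | PPD.IsSaddlePerturbation p f lam x₀ (fun t => ξ t ω) t ∧
      PPD.Stuck p f lam (PPD.run p f lam x₀ (fun t => ξ t ω) t).x
        ((PPD.run p f lam x₀ (fun t => ξ t ω) t).x + ξ t ω)} with hbaddef
  have hbadm : MeasurableSet bad :=
    Finset.measurableSet_biUnion _ fun t _ => hs.measurableSet_stuck hξ x₀ t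
  have hbadδ : P bad ≤ ENNReal.ofReal p.δ :=
    hbad.trans (ENNReal.ofReal_le_ofReal (hp.δ₁_mul_le hδ hgap hΔ))
  calc ENNReal.ofReal (1 - p.δ) = 1 - ENNReal.ofReal p.δ := by
        rw [ENNReal.ofReal_sub _ hδ.le, ENNReal.ofReal_one]
    _ ≤ 1 - P bad := tsub_le_tsub_left hbadδ 1
    _ = P badᶜ := (MeasureTheory.prob_compl_eq_one_sub hbadm).symm
    -- The success event need not be measurable: it contains the complement of the measurable set
    -- `bad`.
    _ ≤ _ := MeasureTheory.measure_mono fun ω hω => ?_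
  refine ⟨n, hnK.trans (hp.iterations_le hδ (hgap.trans hΔ) hgap), ?_⟩
  rcases hout : (PPD.run p f lam x₀ (fun t => ξ t ω) n).output with _ | y
  · exact absurd (hs.le_of_output_eq_none hb hout) (not_le.2 hnN)
  · refine ⟨y, rfl, (hs.isSecondOrderStationary_or hout).resolve_right ?_⟩
    rintro ⟨t, ht, hst⟩
    exact hω (Set.mem_biUnion (Finset.mem_coe.2 (Finset.mem_range.2 ht)) hst)
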